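/- Let $D,n\ge 0$ be integers, write $z'=D/2-z$, and $v^{\lambda}=|v|^{\lambda}$, $v^{2\lambda}=|v|^{2\lambda}$ for real vectors $v\in\mathbb R^D$ and $\lambda\in\mathbb C$. Let $v^{\mu_1\cdots\mu_n}$ be the components of the orthogonal projection of $v^{\otimes n}$ onto the symmetric traceless tensors. For $\Delta_1,\Delta_2,\Delta\in\mathbb C$ and $x\in\mathbb R^D$ the conformal triangle is $$\Psi^{\mu_1\cdots\mu_n}_{\Delta_1,\Delta_2,\Delta}(x_1,x_2)=\frac{\left(\frac{x-x_1}{(x-x_1)^2}-\frac{x-x_2}{(x-x_2)^2}\right)^{\mu_1\cdots\mu_n}}{(x_1-x_2)^{\Delta_1+\Delta_2-\Delta+n}(x-x_1)^{\Delta_1-\Delta_2+\Delta-n}(x-x_2)^{\Delta_2-\Delta_1+\Delta-n}} .$$ On functions of $(x_1,x_2)$ let $\hat q_{12}^{2s}$ be multiplication by $(x_1-x_2)^{2s}$, let $\mathcal P_{12}$ exchange the two arguments, and let $\hat p_j^{2s}$ ($j=1,2$) be the integral operator in the $j$-th variable with kernel $a(-s)\,(x_j-y)^{-2(D/2+s)}$,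 where $a(\alpha)=\dfrac{\Gamma(\alpha')}{2^{2\alpha}\pi^{D/2}\Gamma(\alpha)}$. For $u\in\mathbb C$ put $$Q(u)=\hat q_{12}^{2(\frac D2-\Delta_1)}\,\hat p_1^{2(u+\frac{\Delta_2-\Delta_1}{2})}\,\hat q_{12}^{2(u+\frac{\Delta_1+\Delta_2-D}{2})},$$ $$R(u)=\mathcal P_{12}\,\hat q_{12}^{2(u+\frac{D-\Delta_1-\Delta_2}{2})}\,\hat p_2^{2(u+\frac{\Delta_1-\Delta_2}{2})}\,\hat p_1^{2(u+\frac{\Delta_2-\Delta_1}{2})}\,\hat q_{12}^{2(u+\frac{\Delta_1+\Delta_2-D}{2})},$$ $$\delta=\tfrac12(\Delta_1-\Delta_2+\Delta-n),\quad \kappa=\tfrac12(\Delta_1-\Delta_2)-u,\quad \gamma=\tfrac12(\Delta_2-\Delta_1)-u,$$ $$\tau(\alpha,\beta,n)=\frac{\pi^{D/2}\,\Gamma(\beta)\Gamma(\alpha)\Gamma(\alpha'-\beta+n)}{\Gamma(\beta')\Gamma(\alpha'+n)\Gamma(\alpha+\beta)},\qquad q(u)=4^{-\kappa}\,\frac{\Gamma(\frac{\Delta+n}{2}+u)\,\Gamma(\frac{D+n-\Delta+\Delta_2-\Delta_1}{2})}{\Gamma(\frac{D+n-\Delta}{2}-u)\,\Gamma(\frac{\Delta+n+\Delta_1-\Delta_2}{2})},$$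 $$r_{\Delta,n}(u)=(-1)^n\,4^{2u}\,\frac{\Gamma(\frac{\Delta+n}{2}+u)\,\Gamma(\frac{D-\Delta+n}{2}+u)}{\Gamma(\frac{\Delta+n}{2}-u)\,\Gamma(\frac{D-\Delta+n}{2}-u)} .$$ Then, for all pairwise distinct $x_1,x_2,x\in\mathbb R^D$, all indices $\mu_1,\dots,\mu_n$ and all $\Delta_1,\Delta_2,\Delta,u\in\mathbb C$: 1. $\displaystyle Q(u)\,\Psi^{\mu_1\cdots\mu_n}_{\Delta_1,\Delta_2,\Delta}=a(\kappa)\,\tau(\delta',\kappa,n)\,\Psi^{\mu_1\cdots\mu_n}_{\frac{\Delta_1+\Delta_2}{2}+u,\ \frac{\Delta_1+\Delta_2}{2}-u,\ \Delta}$ at $(x_1,x_2)$, with an absolutely convergent integral on the left, whenever $\mathrm{Re}\,\kappa>0$, $\mathrm{Re}(\Delta+2u)>0$ and $\mathrm{Re}(\Delta_1-\Delta_2+\Delta)<D$. If neither $\delta'$ nor $\frac{\Delta+n}{2}+u$ is in $\{0,-1,-2,\dots\}$, the same relation with coefficient $q(u)$ holds for the left-hand side defined by meromorphic continuation in $(\Delta_1,\Delta_2,\Delta,u)$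 from this domain. If neither $\kappa$ nor $\kappa'$ is in $\{0,-1,-2,\dots\}$, then $a(\kappa)\,\tau(\delta',\kappa,n)=q(u)$. 2. $R(u)\,\Psi^{\mu_1\cdots\mu_n}_{\Delta_1,\Delta_2,\Delta}=r_{\Delta,n}(u)\,\Psi^{\mu_1\cdots\mu_n}_{\Delta_1,\Delta_2,\Delta}$ at $(x_1,x_2)$, with an absolutely convergent iterated integral on the left, whenever $\mathrm{Re}\,\kappa>0$, $\mathrm{Re}\,\gamma>0$, $\mathrm{Re}(\Delta+2u)>0$, $\mathrm{Re}(\Delta-2u)<D$ and $0<\mathrm{Re}(\Delta_1-\Delta_2+\Delta)<D$. If neither $\frac{\Delta+n}{2}+u$ nor $\frac{D-\Delta+n}{2}+u$ is in $\{0,-1,-2,\dots\}$, the same relation holds for the left-hand side defined by meromorphic continuation in $(\Delta_1,\Delta_2,\Delta,u)$ from this domain. As meromorphic functions of the parameters, $r_{\Delta,n}(u)=(-1)^n q(u)/q(-u)$. Here $1/\Gamma$ is read as $0$ at the poles of $\Gamma$. -/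

import Mathlib

noncomputable section

namespace ConformalTriangle

/-- Euclidean space `ℝ^D`. -/
abbrev Space (D : ℕ) : Type := EuclideanSpace ℝ (Fin D)

/-- Real tensors of rank `n` over `ℝ^D`, with the standard inner product. -/
abbrev Tensor (D n : ℕ) : Type := EuclideanSpace ℝ (Fin n → Fin D)

/-- The subspace of tensors of rank `n` that are symmetric under all permutations of the indices and
have vanishing trace in every pair of indices. -/
def symTraceless (D n : ℕ) : Submodule ℝ (Tensor D n) where
  carrier := {T | (∀ (σ : Equiv.Perm (Fin n)) (μ : Fin n → Fin D), T (μ ∘ σ) = T μ) ∧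
    ∀ (i j : Fin n), i ≠ j → ∀ μ : Fin n → Fin D,
      ∑ a : Fin D, T (Function.update (Function.update μ i a) j a) = 0}
  add_mem' := by
    rintro S T ⟨hS, hS'⟩ ⟨hT, hT'⟩
    refine ⟨fun σ μ => ?_, fun i j hij μ => ?_⟩
    · simp [hS, hT]
    · simp [Finset.sum_add_distrib, hS' i j hij, hT' i j hij]
  zero_mem' := by simp
  smul_mem' := by
    rintro c T ⟨hT, hT'⟩
    refine ⟨fun σ μ => ?_, fun i j hij μ => ?_⟩
    · simp [hT]
    · simp [← Finset.mul_sum, hT' i j hij]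

/-- The tensor power `v^{μ₁} ⋯ v^{μₙ}`. -/
def tensorPower {D : ℕ} (n : ℕ) (v : Space D) : Tensor D n :=
  WithLp.toLp 2 fun μ => ∏ i, v (μ i)

/-- The component `v^{μ₁…μₙ}` of the symmetric traceless part of `v^{μ₁} ⋯ v^{μₙ}`. -/
def tracelessPower {D n : ℕ} (v : Space D) (μ : Fin n → Fin D) : ℝ :=
  (symTraceless D n).starProjection (tensorPower n v) μ

/-- The inversion `v / v²`. -/
def inversion {D : ℕ} (v : Space D) : Space D := (‖v‖ ^ 2)⁻¹ • v

/-- The complex power `|v|^s` of the Euclidean norm. -/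
def normPow {D : ℕ} (v : Space D) (s : ℂ) : ℂ := (‖v‖ : ℂ) ^ s

/-- Complex-valued functions `f(x₁, x₂)` of two points of `ℝ^D`. -/
abbrev TwoPoint (D : ℕ) : Type := Space D → Space D → ℂ

/-- The component `μ` of the conformal triangle with dimensions `Δ₁, Δ₂, Δ` and third point `x`,
as a function of `x₁, x₂`. -/
def triangle {D n : ℕ} (Δ₁ Δ₂ Δ : ℂ) (μ : Fin n → Fin D) (x : Space D) : TwoPoint D :=
  fun x₁ x₂ =>
    (tracelessPower (inversion (x - x₁) - inversion (x - x₂)) μ : ℂ) /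
      (normPow (x₁ - x₂) (Δ₁ + Δ₂ - Δ + n) *
        normPow (x - x₁) (Δ₁ - Δ₂ + Δ - n) *
        normPow (x - x₂) (Δ₂ - Δ₁ + Δ - n))

/-- `a(α) = Γ(D/2 - α) / (2^{2α} π^{D/2} Γ(α))`. -/
def aCoeff (D : ℕ) (α : ℂ) : ℂ :=
  Complex.Gamma (D / 2 - α) /
    ((2 : ℂ) ^ (2 * α) * (Real.pi : ℂ) ^ ((D : ℂ) / 2) * Complex.Gamma α)

/-- The kernel of `p̂^{2s}` on `ℝ^D`, without its constant: `|x - y|^{-2(D/2 + s)}`. -/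
def pKernel {D : ℕ} (s : ℂ) (x y : Space D) : ℂ := normPow (x - y) (-((D : ℂ) + 2 * s))

/-- Multiplication by `(x₁ - x₂)^{2s}`, that is, the operator `q̂₁₂^{2s}`. -/
def q₁₂ {D : ℕ} (s : ℂ) (f : TwoPoint D) : TwoPoint D :=
  fun x₁ x₂ => normPow (x₁ - x₂) (2 * s) * f x₁ x₂

/-- The operator `p̂₁^{2s}`, given by its integral kernel `a(-s) |x₁ - y|^{-2(D/2 + s)}`. -/
def p₁ {D : ℕ} (s : ℂ) (f : TwoPoint D) : TwoPoint D :=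
  fun x₁ x₂ => aCoeff D (-s) * ∫ y : Space D, pKernel s x₁ y * f y x₂

/-- The operator `p̂₂^{2s}`, given by its integral kernel `a(-s) |x₂ - y|^{-2(D/2 + s)}`. -/
def p₂ {D : ℕ} (s : ℂ) (f : TwoPoint D) : TwoPoint D :=
  fun x₁ x₂ => aCoeff D (-s) * ∫ y : Space D, pKernel s x₂ y * f x₁ y

/-- The integral defining `(p̂₁^{2s} f)(x₁, x₂)` converges absolutely. -/
def Converges₁ {D : ℕ} (s : ℂ) (f : TwoPoint D) (x₁ x₂ : Space D) : Prop :=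
  MeasureTheory.Integrable (fun y : Space D => pKernel s x₁ y * f y x₂)

/-- The integral defining `(p̂₂^{2s} f)(x₁, x₂)` converges absolutely. -/
def Converges₂ {D : ℕ} (s : ℂ) (f : TwoPoint D) (x₁ x₂ : Space D) : Prop :=
  MeasureTheory.Integrable (fun y : Space D => pKernel s x₂ y * f x₁ y)

/-- The permutation operator `𝒫₁₂`. -/
def perm₁₂ {D : ℕ} (f : TwoPoint D) : TwoPoint D := fun x₁ x₂ => f x₂ x₁

/-- The factor operator
`Q(u) = q̂₁₂^{2(D/2 - Δ₁)} p̂₁^{2(u + (Δ₂ - Δ₁)/2)} q̂₁₂^{2(u + (Δ₁ + Δ₂ - D)/2)}`. -/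
def Qop {D : ℕ} (Δ₁ Δ₂ u : ℂ) (f : TwoPoint D) : TwoPoint D :=
  q₁₂ ((D : ℂ) / 2 - Δ₁) <| p₁ (u + (Δ₂ - Δ₁) / 2) <| q₁₂ (u + (Δ₁ + Δ₂ - D) / 2) f

/-- The R-operator
`R(u) = 𝒫₁₂ q̂₁₂^{2(u + (D - Δ₁ - Δ₂)/2)} p̂₂^{2(u + (Δ₁ - Δ₂)/2)} p̂₁^{2(u + (Δ₂ - Δ₁)/2)}
  q̂₁₂^{2(u + (Δ₁ + Δ₂ - D)/2)}`. -/
def Rop {D : ℕ} (Δ₁ Δ₂ u : ℂ) (f : TwoPoint D) : TwoPoint D :=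
  perm₁₂ <| q₁₂ (u + (D - Δ₁ - Δ₂) / 2) <| p₂ (u + (Δ₁ - Δ₂) / 2) <|
    p₁ (u + (Δ₂ - Δ₁) / 2) <| q₁₂ (u + (Δ₁ + Δ₂ - D) / 2) f

/-- The integral in `(Q(u) f)(x₁, x₂)` converges absolutely. -/
def QConverges {D : ℕ} (Δ₁ Δ₂ u : ℂ) (f : TwoPoint D) (x₁ x₂ : Space D) : Prop :=
  Converges₁ (u + (Δ₂ - Δ₁) / 2) (q₁₂ (u + (Δ₁ + Δ₂ - D) / 2) f) x₁ x₂

/-- The iterated integral in `(R(u) f)(x₁, x₂)` converges absolutely: the outer one, and the inner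
one for almost every value of the outer integration variable. -/
def RConverges {D : ℕ} (Δ₁ Δ₂ u : ℂ) (f : TwoPoint D) (x₁ x₂ : Space D) : Prop :=
  (∀ᵐ y : Space D,
    Converges₁ (u + (Δ₂ - Δ₁) / 2) (q₁₂ (u + (Δ₁ + Δ₂ - D) / 2) f) x₂ y) ∧
  Converges₂ (u + (Δ₁ - Δ₂) / 2)
    (p₁ (u + (Δ₂ - Δ₁) / 2) (q₁₂ (u + (Δ₁ + Δ₂ - D) / 2) f)) x₂ x₁

/-- The coefficient of the tensor star-triangle relation,
`τ(α, β, n) = π^{D/2} Γ(β) Γ(α) Γ(α' - β + n) / (Γ(β') Γ(α' + n) Γ(α + β))`, where `z' = D/2 - z`. -/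
def tau (D : ℕ) (α β : ℂ) (n : ℕ) : ℂ :=
  (Real.pi : ℂ) ^ ((D : ℂ) / 2) * Complex.Gamma β * Complex.Gamma α *
      Complex.Gamma ((D : ℂ) / 2 - α - β + n) /
    (Complex.Gamma ((D : ℂ) / 2 - β) * Complex.Gamma ((D : ℂ) / 2 - α + n) *
      Complex.Gamma (α + β))

/-- `δ = (Δ₁ - Δ₂ + Δ - n) / 2`. -/
def delta (n : ℕ) (Δ₁ Δ₂ Δ : ℂ) : ℂ := (Δ₁ - Δ₂ + Δ - n) / 2

/-- `κ = (Δ₁ - Δ₂) / 2 - u`. -/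
def kappa (Δ₁ Δ₂ u : ℂ) : ℂ := (Δ₁ - Δ₂) / 2 - u

/-- The Gamma-function form of the coefficient of `Q(u)` on the conformal triangle. -/
def qCoeff (D n : ℕ) (Δ₁ Δ₂ Δ u : ℂ) : ℂ :=
  (4 : ℂ) ^ ((Δ₂ - Δ₁) / 2 + u) *
    (Complex.Gamma ((Δ + n) / 2 + u) * Complex.Gamma ((D + n - Δ + Δ₂ - Δ₁) / 2)) /
    (Complex.Gamma ((D + n - Δ) / 2 - u) * Complex.Gamma ((Δ + n + Δ₁ - Δ₂) / 2))

/-- The eigenvalue `r_{Δ,n}(u)` of the R-operator. -/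
def rEigenvalue (D n : ℕ) (Δ u : ℂ) : ℂ :=
  (-1) ^ n * (4 : ℂ) ^ (2 * u) *
    (Complex.Gamma ((Δ + n) / 2 + u) / Complex.Gamma ((Δ + n) / 2 - u)) *
    (Complex.Gamma ((D - Δ + n) / 2 + u) / Complex.Gamma ((D - Δ + n) / 2 - u))

/-- `z` is not a pole of the Gamma function. -/
def GammaRegular (z : ℂ) : Prop := ∀ m : ℕ, z ≠ -(m : ℂ)

/-- The parameters `(Δ₁, Δ₂, Δ, u)`. -/
abbrev Params : Type := ℂ × ℂ × ℂ × ℂ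

/-- A tube of parameters `(Δ₁, Δ₂, Δ, u)` for the operator `Q(u)` on the conformal triangle. -/
def QTube (D : ℕ) : Set Params :=
  {P | 0 < (kappa P.1 P.2.1 P.2.2.2).re ∧
    0 < (P.2.2.1 + 2 * P.2.2.2).re ∧
    (P.1 - P.2.1 + P.2.2.1).re < D}

/-- A tube of parameters `(Δ₁, Δ₂, Δ, u)` for the operator `R(u)` on the conformal triangle. -/
def RTube (D : ℕ) : Set Params :=
  {P | 0 < (kappa P.1 P.2.1 P.2.2.2).re ∧ 0 < (kappa P.2.1 P.1 P.2.2.2).re ∧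
    0 < (P.2.2.1 + 2 * P.2.2.2).re ∧ (P.2.2.1 - 2 * P.2.2.2).re < D ∧
    0 < (P.1 - P.2.1 + P.2.2.1).re ∧ (P.1 - P.2.1 + P.2.2.1).re < D}

/-- The function `F`, given on the nonempty open set `Ω`, has a meromorphic continuation (a quotient
`g / h` of entire functions) that is regular at `P` and takes the value `v` there. -/
def ContinuesTo {V : Type*} [NormedAddCommGroup V] [NormedSpace ℂ V]
    (Ω : Set V) (F : V → ℂ) (P : V) (v : ℂ) : Prop :=
  IsOpen Ω ∧ Ω.Nonempty ∧
    ∃ g h : V → ℂ, Differentiable ℂ g ∧ Differentiable ℂ h ∧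
      (∀ q ∈ Ω, h q * F q = g q) ∧ h P ≠ 0 ∧ h P * v = g P

/-- The value of the continuation is unique. -/
theorem ContinuesTo.unique {V : Type*} [NormedAddCommGroup V] [NormedSpace ℂ V]
    {Ω : Set V} {F : V → ℂ} {P : V} {v w : ℂ}
    (hv : ContinuesTo Ω F P v) (hw : ContinuesTo Ω F P w) : v = w := by
  obtain ⟨ho, ⟨q, hq⟩, g, h, hg, hh, hF, hP, hv⟩ := hv
  obtain ⟨-, -, g', h', hg', hh', hF', hP', hw⟩ := hw
  have hl : Differentiable ℂ (fun t : ℂ => q + t • (P - q)) := by fun_prop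
  set A : ℂ → ℂ := fun t => h' (q + t • (P - q)) * g (q + t • (P - q)) with hA
  set B : ℂ → ℂ := fun t => h (q + t • (P - q)) * g' (q + t • (P - q)) with hB
  have dA : Differentiable ℂ A := (hh'.comp hl).mul (hg.comp hl)
  have dB : Differentiable ℂ B := (hh.comp hl).mul (hg'.comp hl)
  have hAB : A =ᶠ[nhds 0] B := by
    have : ∀ᶠ t in nhds (0 : ℂ), q + t • (P - q) ∈ Ω :=
      hl.continuous.continuousAt.eventually (ho.mem_nhds (by simpa using hq))
    filter_upwards [this] with t ht
    simp only [hA, hB, ← hF _ ht, ← hF' _ ht]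
    ring
  have key : A = B := AnalyticOnNhd.eq_of_eventuallyEq
    (fun z _ => dA.analyticAt z) (fun z _ => dB.analyticAt z) hAB
  have h1 := congrFun key 1
  simp only [hA, hB, one_smul, add_sub_cancel] at h1
  rw [← hv, ← hw] at h1
  have : (h P * h' P) * (v - w) = 0 := by linear_combination h1
  rcases mul_eq_zero.mp this with h0 | h0
  · exact absurd h0 (mul_ne_zero hP hP')
  · exact sub_eq_zero.mp h0

end ConformalTriangle

end

/-! Both relations reduce to one integral, the star-triangle relation with a traceless tensor in the
numerator. An inversion centred at the third point `x` sends that point to infinity. In the inverted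
coordinates the triangle is a traceless form of degree n in v - w times powers of |v - w|, |v| and
|w|. In the integrand of Q(u) the powers of the integration variable |w| cancel against the Jacobian
|w|^(-2D) (`qIntegrand_inversion`). What remains is the convolution of a Riesz kernel with a power
of the norm times a harmonic polynomial H (`riesz_convolution`).

That convolution is computed by writing both powers as one Schwinger integral over (c, t). For fixed
(c, t) the integral over w is Gaussian, and a harmonic polynomial integrated against a Gaussian
takes its value at the centre, up to the total mass (`integral_tensorPoly_mul_gaussian`). Hence H(z)
factors out, the t-integral is a Gamma integral and the c-integral a Beta integral. Exchanging the
integrals is justified by the same Schwinger formula at the real parts of the exponents.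

R(u) needs no new integral. Its inner integral is that of Q(u), up to a power of the distance, and
yields a triangle with shifted dimensions. The outer integral is that of a second Q, which restores
the original dimensions. The exchange of arguments between the two gives (-1)^n, and the eigenvalue
is the product of the two coefficients (`outer_integrand_eq`, `rEigenvalue_eq_mul_qCoeff`).

The continuations follow because 1/Γ is entire: multiplying by the reciprocals of the Gamma
functions in the numerator leaves an entire function of the parameters. -/

namespace ConformalTriangle

open MeasureTheory Set

/-! ### The Beta integral over the half-line -/

/-- A complex power of a positive real number as an exponential. -/
theorem ofReal_cpow_eq_exp {x : ℝ} (hx : 0 < x) (s : ℂ) :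
    (x : ℂ) ^ s = Complex.exp (Real.log x * s) := by
  rw [Complex.cpow_def_of_ne_zero (by exact_mod_cast hx.ne'), Complex.ofReal_log hx.le]

theorem image_div_one_sub {k : ℝ} (hk : 0 < k) :
    (fun x : ℝ => k * (x / (1 - x))) '' Ioo 0 1 = Ioi 0 := by
  ext c
  simp only [mem_image, mem_Ioo, mem_Ioi]
  constructor
  · rintro ⟨x, ⟨h0, h1⟩, rfl⟩
    have : 0 < 1 - x := by linarith
    positivity
  · intro hc
    refine ⟨c / (k + c), ⟨by positivity, by rw [div_lt_one (by positivity)]; linarith⟩, ?_⟩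
    have : 1 - c / (k + c) = k / (k + c) := by field_simp; ring
    rw [this]
    field_simp

theorem injOn_div_one_sub {k : ℝ} (hk : 0 < k) :
    InjOn (fun x : ℝ => k * (x / (1 - x))) (Ioo 0 1) := by
  intro x hx y hy h
  have h1 : (1 - x) ≠ 0 := by linarith [hx.2]
  have h2 : (1 - y) ≠ 0 := by linarith [hy.2]
  have h3 : x / (1 - x) = y / (1 - y) := mul_left_cancel₀ hk.ne' h
  rw [div_eq_div_iff h1 h2] at h3
  linarith

theorem hasDerivAt_div_one_sub (k : ℝ) {x : ℝ} (hx : x ∈ Ioo (0 : ℝ) 1) :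
    HasDerivAt (fun x : ℝ => k * (x / (1 - x))) (k / (1 - x) ^ 2) x := by
  have h1 : (1 - x) ≠ 0 := by linarith [hx.2]
  have := ((hasDerivAt_id x).div ((hasDerivAt_id x).const_sub 1) h1).const_mul k
  refine this.congr_deriv ?_
  simp only [id]
  field_simp
  ring

/-- The integrand of the Beta integral over the half-line after the substitution
`c = (A / B) x / (1 - x)`. -/
theorem beta_integrand_subst {p q : ℂ} {A B x : ℝ} (hA : 0 < A) (hB : 0 < B)
    (hx : x ∈ Ioo (0 : ℝ) 1) :
    |A / B / (1 - x) ^ 2| • (((A / B * (x / (1 - x)) : ℝ) : ℂ) ^ (p - 1) *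
      ((A + (A / B * (x / (1 - x))) * B : ℝ) : ℂ) ^ (-(p + q))) =
    (A : ℂ) ^ (-q) * (B : ℂ) ^ (-p) * ((x : ℂ) ^ (p - 1) * (1 - (x : ℂ)) ^ (q - 1)) := by
  have hx0 : 0 < x := hx.1
  have hx1 : 0 < 1 - x := by linarith [hx.2]
  have e1 : A + (A / B * (x / (1 - x))) * B = A / (1 - x) := by
    field_simp; ring
  have e2 : (1 - (x : ℂ)) = ((1 - x : ℝ) : ℂ) := by push_cast; ring
  have e3 : |A / B / (1 - x) ^ 2| = Real.exp (Real.log A - Real.log B - 2 * Real.log (1 - x)) := by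
    rw [abs_of_pos (by positivity), Real.exp_sub, Real.exp_sub, Real.exp_log hA, Real.exp_log hB,
      two_mul, Real.exp_add, Real.exp_log hx1, sq]
  rw [e1, e2, e3, Complex.real_smul, ofReal_cpow_eq_exp (by positivity),
    ofReal_cpow_eq_exp (by positivity), ofReal_cpow_eq_exp hA, ofReal_cpow_eq_exp hB,
    ofReal_cpow_eq_exp hx0, ofReal_cpow_eq_exp hx1, Complex.ofReal_exp, ← Complex.exp_add,
    ← Complex.exp_add, ← Complex.exp_add, ← Complex.exp_add, ← Complex.exp_add,
    Real.log_div hA.ne' hx1.ne', Real.log_mul (by positivity) (by positivity),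
    Real.log_div hA.ne' hB.ne', Real.log_div hx0.ne' hx1.ne']
  congr 1
  push_cast
  ring

theorem integrableOn_beta {p q : ℂ} (hp : 0 < p.re) (hq : 0 < q.re) {A B : ℝ} (hA : 0 < A)
    (hB : 0 < B) :
    IntegrableOn (fun c : ℝ => (c : ℂ) ^ (p - 1) * ((A + c * B : ℝ) : ℂ) ^ (-(p + q)))
      (Ioi 0) := by
  rw [← image_div_one_sub (div_pos hA hB), integrableOn_image_iff_integrableOn_abs_deriv_smul
    measurableSet_Ioo (fun x hx => (hasDerivAt_div_one_sub (A / B) hx).hasDerivWithinAt)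
    (injOn_div_one_sub (div_pos hA hB))]
  rw [integrableOn_congr_fun (fun x hx => beta_integrand_subst hA hB hx) measurableSet_Ioo]
  have := Complex.betaIntegral_convergent hp hq
  rw [intervalIntegrable_iff_integrableOn_Ioo_of_le zero_le_one] at this
  exact this.const_mul _

/-- The Beta integral over the half-line. -/
theorem integral_beta {p q : ℂ} (hp : 0 < p.re) (hq : 0 < q.re) {A B : ℝ} (hA : 0 < A)
    (hB : 0 < B) :
    ∫ c in Ioi (0 : ℝ), (c : ℂ) ^ (p - 1) * ((A + c * B : ℝ) : ℂ) ^ (-(p + q)) =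
      (A : ℂ) ^ (-q) * (B : ℂ) ^ (-p) *
        (Complex.Gamma p * Complex.Gamma q / Complex.Gamma (p + q)) := by
  rw [← image_div_one_sub (div_pos hA hB), integral_image_eq_integral_abs_deriv_smul
    measurableSet_Ioo (fun x hx => (hasDerivAt_div_one_sub (A / B) hx).hasDerivWithinAt)
    (injOn_div_one_sub (div_pos hA hB))]
  rw [setIntegral_congr_fun measurableSet_Ioo (fun x hx => beta_integrand_subst hA hB hx)]
  rw [integral_const_mul, Complex.Gamma_mul_Gamma_eq_betaIntegral hp hq,
    mul_div_cancel_left₀ _ (Complex.Gamma_ne_zero_of_re_pos (by simpa using add_pos hp hq)),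
    Complex.betaIntegral, intervalIntegral.integral_of_le zero_le_one, integral_Ioc_eq_integral_Ioo]

/-! ### The two-parameter Schwinger representation -/

/-- The integrand of the two-parameter Schwinger representation of `A^{-α} B^{-β}`. -/
noncomputable def schwinger (α β : ℂ) (A B : ℝ) (r : ℝ × ℝ) : ℂ :=
  (r.1 : ℂ) ^ (β - 1) * ((r.2 : ℂ) ^ (α + β - 1) * Complex.exp (-(((A + r.1 * B : ℝ) : ℂ) * r.2)))

/-- Lebesgue measure on the open quadrant. -/
noncomputable def quadrant : Measure (ℝ × ℝ) :=
  (volume.restrict (Ioi (0 : ℝ))).prod (volume.restrict (Ioi (0 : ℝ)))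

instance : SFinite quadrant := by unfold quadrant; infer_instance

/-- A, B and r all vary with x because Fubini needs joint measurability in the point w and the pair
(c, t). -/
theorem measurable_schwinger {X : Type*} [MeasurableSpace X] (α β : ℂ) {A B : X → ℝ}
    {r : X → ℝ × ℝ} (hA : Measurable A) (hB : Measurable B) (hr : Measurable r) :
    Measurable fun x => schwinger α β (A x) (B x) (r x) := by
  unfold schwinger
  have h1 : Measurable fun x => (((r x).1 : ℝ) : ℂ) := by fun_prop
  have h2 : Measurable fun x => (((r x).2 : ℝ) : ℂ) := by fun_prop
  refine (h1.pow_const _).mul ((h2.pow_const _).mul ?_)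
  fun_prop

/-- The integrand at the real parts reappears, so the closed formula for the integral also evaluates
the integral of the norm. The cast to ℂ makes that formula applicable. -/
theorem norm_schwinger (α β : ℂ) (A B : ℝ) {r : ℝ × ℝ} (h1 : 0 < r.1) (h2 : 0 < r.2) :
    (‖schwinger α β A B r‖ : ℂ) = schwinger α.re β.re A B r := by
  rw [schwinger, norm_mul, norm_mul, Complex.norm_cpow_eq_rpow_re_of_pos h1,
    Complex.norm_cpow_eq_rpow_re_of_pos h2, Complex.norm_exp, schwinger]
  push_cast
  rw [Complex.ofReal_cpow h1.le, Complex.ofReal_cpow h2.le]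
  simp

theorem integrableOn_cpow_mul_exp {a : ℂ} (ha : 0 < a.re) {r : ℝ} (hr : 0 < r) :
    IntegrableOn (fun t : ℝ => (t : ℂ) ^ (a - 1) * Complex.exp (-(r * t))) (Ioi 0) := by
  have h := integrableOn_rpow_mul_exp_neg_mul_rpow (p := 1) (s := a.re - 1) (b := r)
    (by linarith) one_pos hr
  refine Integrable.mono' h ?_ ?_
  · refine Measurable.aestronglyMeasurable ?_
    have h1 : Measurable fun t : ℝ => (t : ℂ) := by fun_prop
    exact (h1.pow_const _).mul (by fun_prop)
  · filter_upwards [ae_restrict_mem measurableSet_Ioi] with t ht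
    rw [norm_mul, Complex.norm_cpow_eq_rpow_re_of_pos ht, Complex.norm_exp]
    simp

theorem integral_schwinger_snd {α β : ℂ} (h : 0 < (α + β).re) {A B c : ℝ} (hA : 0 < A)
    (hB : 0 < B) (hc : 0 < c) :
    ∫ t in Ioi (0 : ℝ), schwinger α β A B (c, t) =
      Complex.Gamma (α + β) * ((c : ℂ) ^ (β - 1) * ((A + c * B : ℝ) : ℂ) ^ (-(β + α))) := by
  have hr : 0 < A + c * B := by positivity
  simp only [schwinger]
  rw [integral_const_mul, Complex.integral_cpow_mul_exp_neg_mul_Ioi h (by exact_mod_cast hr),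
    one_div, Complex.inv_cpow _ _ (by
      rw [Complex.arg_ofReal_of_nonneg hr.le]; exact Real.pi_pos.ne), ← Complex.cpow_neg,
    add_comm β α]
  ring

/-- By Tonelli: the t-integral of the norm is a Gamma integral, and what it leaves is the Beta
integrand at the real parts. -/
theorem integrable_schwinger {α β : ℂ} (hα : 0 < α.re) (hβ : 0 < β.re) {A B : ℝ} (hA : 0 < A)
    (hB : 0 < B) : Integrable (schwinger α β A B) quadrant := by
  have hαβ : 0 < (α + β).re := by simpa using add_pos hα hβ
  have hre : 0 < ((α.re : ℂ) + (β.re : ℂ)).re := by simpa using hαβ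
  have hm : Measurable (schwinger α β A B) :=
    measurable_schwinger α β measurable_const measurable_const measurable_id
  unfold quadrant
  rw [integrable_prod_iff hm.aestronglyMeasurable]
  constructor
  · filter_upwards [ae_restrict_mem measurableSet_Ioi] with c hc
    have hr : 0 < A + c * B := by have : 0 < c := hc; positivity
    exact (integrableOn_cpow_mul_exp hαβ hr).const_mul ((c : ℂ) ^ (β - 1))
  · have hb := (integrableOn_beta (p := (β.re : ℂ)) (q := (α.re : ℂ)) (by simpa) (by simpa)
      hA hB).const_mul (Complex.Gamma ((α.re : ℂ) + (β.re : ℂ)))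
    refine hb.re.congr ?_
    filter_upwards [ae_restrict_mem measurableSet_Ioi] with c hc
    rw [← integral_schwinger_snd hre hA hB hc,
      ← setIntegral_congr_fun measurableSet_Ioi (fun t ht => norm_schwinger α β A B (r := (c, t)) hc ht),
      integral_complex_ofReal]
    simp

/-- The two-parameter Schwinger representation. -/
theorem integral_schwinger {α β : ℂ} (hα : 0 < α.re) (hβ : 0 < β.re) {A B : ℝ} (hA : 0 < A)
    (hB : 0 < B) :
    ∫ r, schwinger α β A B r ∂quadrant =
      Complex.Gamma α * Complex.Gamma β * ((A : ℂ) ^ (-α) * (B : ℂ) ^ (-β)) := by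
  have hαβ : 0 < (α + β).re := by simpa using add_pos hα hβ
  have h := integrable_schwinger hα hβ hA hB
  unfold quadrant at h ⊢
  rw [integral_prod _ h, setIntegral_congr_fun measurableSet_Ioi
    (fun c hc => integral_schwinger_snd hαβ hA hB hc), integral_const_mul,
    integral_beta hβ hα hA hB, add_comm β α]
  have := Complex.Gamma_ne_zero_of_re_pos hαβ
  field_simp

theorem ae_quadrant_pos : ∀ᵐ r ∂quadrant, 0 < r.1 ∧ 0 < r.2 := by
  unfold quadrant
  rw [Measure.prod_restrict]
  filter_upwards [ae_restrict_mem (measurableSet_Ioi.prod measurableSet_Ioi)] with r hr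
  exact ⟨hr.1, hr.2⟩

theorem integral_norm_schwinger {α β : ℂ} (hα : 0 < α.re) (hβ : 0 < β.re) {A B : ℝ} (hA : 0 < A)
    (hB : 0 < B) :
    ∫ r, ‖schwinger α β A B r‖ ∂quadrant =
      Real.Gamma α.re * Real.Gamma β.re * (A ^ (-α.re) * B ^ (-β.re)) := by
  have h := integral_schwinger (α := (α.re : ℂ)) (β := (β.re : ℂ)) (by simpa) (by simpa) hA hB
  rw [← integral_congr_ae (ae_quadrant_pos.mono fun r hr => norm_schwinger α β A B hr.1 hr.2),
    integral_complex_ofReal, Complex.Gamma_ofReal, Complex.Gamma_ofReal, ← Complex.ofReal_neg,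
    ← Complex.ofReal_neg, ← Complex.ofReal_cpow hA.le, ← Complex.ofReal_cpow hB.le] at h
  exact_mod_cast h

/-! ### Traceless tensors and their contractions -/

/-- A rank `n` array with vanishing trace in every pair of indices. -/
def IsTraceless {D n : ℕ} (T : (Fin n → Fin D) → ℝ) : Prop :=
  ∀ i j : Fin n, i ≠ j → ∀ μ : Fin n → Fin D,
    ∑ a : Fin D, T (Function.update (Function.update μ i a) j a) = 0

/-- The homogeneous polynomial with coefficients `T`. -/
noncomputable def tensorPoly {D n : ℕ} (T : (Fin n → Fin D) → ℝ) (w : Space D) : ℝ :=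
  ∑ ν, T ν * ∏ i, w (ν i)

theorem sum_cons {D n : ℕ} (f : (Fin (n + 1) → Fin D) → ℝ) :
    ∑ ν, f ν = ∑ a, ∑ ν, f (Fin.cons a ν) := by
  rw [← Fintype.sum_prod_type']
  exact (Equiv.sum_comp (Fin.consEquiv fun _ => Fin D) f).symm

theorem sum_eq_zero_of_sum_update {D n : ℕ} (j : Fin n) (f : (Fin n → Fin D) → ℝ)
    (h : ∀ ν, ∑ b, f (Function.update ν j b) = 0) : ∑ ν, f ν = 0 := by
  rw [← Equiv.sum_comp (Equiv.funSplitAt j (Fin D)).symm f, Fintype.sum_prod_type,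
    Finset.sum_comm]
  refine Finset.sum_eq_zero fun r _ => ?_
  -- For empty `Fin D` the sum over b is empty. Otherwise any b₀ can fill position j, since the
  -- update overwrites it.
  by_cases hD : Nonempty (Fin D)
  · obtain ⟨b₀⟩ := hD
    rw [← h ((Equiv.funSplitAt j (Fin D)).symm (b₀, r))]
    refine Finset.sum_congr rfl fun b _ => congrArg f ?_
    ext i
    by_cases hi : i = j
    · subst hi; simp [Equiv.funSplitAt, Equiv.piSplitAt]
    · simp [Equiv.funSplitAt, Equiv.piSplitAt, hi]
  · exact Finset.sum_eq_zero fun b _ => absurd ⟨b⟩ hD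

theorem IsTraceless.slice {D n : ℕ} {T : (Fin (n + 1) → Fin D) → ℝ} (hT : IsTraceless T)
    (a : Fin D) : IsTraceless fun ν => T (Fin.cons a ν) := by
  intro i j hij μ
  have := hT i.succ j.succ (by simpa using hij) (Fin.cons a μ)
  simpa only [← Fin.cons_update] using this

/-- Since M does not see the j-th index, summing over that index alone is a trace of T in the
positions 0 and j + 1. -/
theorem IsTraceless.sum_contraction {D n : ℕ} {T : (Fin (n + 1) → Fin D) → ℝ}
    (hT : IsTraceless T) (j : Fin n) (M : (Fin n → Fin D) → ℝ)
    (hM : ∀ ν b, M (Function.update ν j b) = M ν) :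
    ∑ ν, T (Fin.cons (ν j) ν) * M ν = 0 := by
  refine sum_eq_zero_of_sum_update j _ fun ν => ?_
  simp only [hM, Function.update_self, ← Finset.sum_mul]
  have := hT 0 j.succ (Fin.succ_ne_zero j).symm (Fin.cons (ν j) ν)
  simp only [Fin.update_cons_zero, ← Fin.cons_update] at this
  rw [this, zero_mul]

theorem abs_coord_le {D : ℕ} (w : Space D) (a : Fin D) : |w a| ≤ ‖w‖ :=
  PiLp.norm_apply_le w a

theorem abs_prod_coord_le {D n : ℕ} (w : Space D) (ν : Fin n → Fin D) (s : Finset (Fin n)) :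
    |∏ i ∈ s, w (ν i)| ≤ ‖w‖ ^ s.card := by
  rw [Finset.abs_prod]
  rw [← Finset.prod_const]
  exact Finset.prod_le_prod (fun i _ => abs_nonneg _) fun i _ => abs_coord_le w _

/-! ### Gaussian moments and the mean value property -/

theorem integrable_exp_neg_mul_sq_norm {D : ℕ} {c : ℝ} (hc : 0 < c) :
    Integrable fun y : Space D => Real.exp (-c * ‖y‖ ^ 2) := by
  have := (GaussianFourier.integrable_cexp_neg_mul_sq_norm_add (V := Space D) (b := (c : ℂ))
    (by simpa) 0 0).norm
  refine this.congr (.of_forall fun y => ?_)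
  simp only [Complex.norm_exp]
  congr 1
  simp [← Complex.ofReal_pow]

/-- Half of the Gaussian absorbs polynomial growth: (r + V)^p ≤ p! exp(r + V), and r ≤ (c/2) r² +
1/(2c) by completing the square. -/
theorem pow_mul_exp_neg_le {c r : ℝ} (hc : 0 < c) (V : ℝ) (hr : 0 ≤ r + V) (p : ℕ) :
    (r + V) ^ p * Real.exp (-c * r ^ 2) ≤
      (p.factorial * Real.exp (V + 1 / (2 * c))) * Real.exp (-(c / 2) * r ^ 2) := by
  have h1 : (r + V) ^ p ≤ p.factorial * Real.exp (r + V) := by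
    have := Real.pow_div_factorial_le_exp (r + V) hr p
    rwa [div_le_iff₀' (by positivity)] at this
  have h2 : r + V + -c * r ^ 2 ≤ V + 1 / (2 * c) + -(c / 2) * r ^ 2 := by
    have : 0 ≤ (c * r - 1) ^ 2 / (2 * c) := by positivity
    have e : (c * r - 1) ^ 2 / (2 * c) = c / 2 * r ^ 2 - r + 1 / (2 * c) := by
      field_simp; ring
    linarith
  calc (r + V) ^ p * Real.exp (-c * r ^ 2)
      ≤ p.factorial * Real.exp (r + V) * Real.exp (-c * r ^ 2) := by gcongr
    _ = p.factorial * Real.exp (r + V + -c * r ^ 2) := by rw [Real.exp_add (r + V)]; ring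
    _ ≤ p.factorial * Real.exp (V + 1 / (2 * c) + -(c / 2) * r ^ 2) := by gcongr
    _ = _ := by rw [Real.exp_add (V + _)]; ring

theorem integrable_mul_gaussian {D : ℕ} {c : ℝ} (hc : 0 < c) (v : Space D) {F : Space D → ℝ}
    (hF : Continuous F) (p : ℕ) (C : ℝ) (hb : ∀ y, |F y| ≤ C * ‖y‖ ^ p) :
    Integrable fun y : Space D => F y * Real.exp (-c * ‖y - v‖ ^ 2) := by
  have h := ((integrable_exp_neg_mul_sq_norm (D := D) (half_pos hc)).const_mul
    (|C| * (p.factorial * Real.exp (‖v‖ + 1 / (2 * c))))).comp_sub_right v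
  refine h.mono' (by fun_prop) (.of_forall fun y => ?_)
  rw [Real.norm_eq_abs, abs_mul, Real.abs_exp]
  have h1 : ‖y‖ ≤ ‖y - v‖ + ‖v‖ := by simpa using norm_add_le (y - v) v
  have h2 : |F y| ≤ |C| * (‖y - v‖ + ‖v‖) ^ p :=
    (hb y).trans (by gcongr; exact le_abs_self C)
  calc |F y| * Real.exp (-c * ‖y - v‖ ^ 2)
      ≤ |C| * (‖y - v‖ + ‖v‖) ^ p * Real.exp (-c * ‖y - v‖ ^ 2) := by gcongr
    _ = |C| * ((‖y - v‖ + ‖v‖) ^ p * Real.exp (-c * ‖y - v‖ ^ 2)) := by ring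
    _ ≤ |C| * ((p.factorial * Real.exp (‖v‖ + 1 / (2 * c))) *
          Real.exp (-(c / 2) * ‖y - v‖ ^ 2)) := by
        exact mul_le_mul_of_nonneg_left (pow_mul_exp_neg_le hc _ (by positivity) p) (abs_nonneg C)
    _ = _ := by ring

theorem hasLineDerivAt_gaussian {D : ℕ} (c : ℝ) (v y : Space D) (a : Fin D) :
    HasLineDerivAt ℝ (fun y : Space D => Real.exp (-c * ‖y - v‖ ^ 2))
      (-(2 * c) * (y a - v a) * Real.exp (-c * ‖y - v‖ ^ 2)) y (EuclideanSpace.single a 1) := by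
  have e : ∀ t : ℝ, ‖y + t • EuclideanSpace.single a (1 : ℝ) - v‖ ^ 2 =
      ‖y - v‖ ^ 2 + 2 * t * (y a - v a) + t ^ 2 := by
    intro t
    rw [add_sub_right_comm, norm_add_sq_real, inner_smul_right, norm_smul,
      EuclideanSpace.inner_single_right]
    simp
    ring
  unfold HasLineDerivAt
  simp only [e]
  have h : HasDerivAt (fun t : ℝ => -c * (‖y - v‖ ^ 2 + 2 * t * (y a - v a) + t ^ 2))
      (-c * (2 * (y a - v a))) 0 := by
    have h1 := ((hasDerivAt_id (0 : ℝ)).const_mul 2).mul_const (y a - v a)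
    have h2 := ((h1.const_add (‖y - v‖ ^ 2)).add (hasDerivAt_pow 2 (0 : ℝ))).const_mul (-c)
    refine h2.congr_deriv ?_
    simp
  refine h.exp.congr_deriv ?_
  simp
  ring

theorem hasLineDerivAt_prod_coord {D n : ℕ} (ν : Fin n → Fin D) (y : Space D) (a : Fin D) :
    HasLineDerivAt ℝ (fun y : Space D => ∏ i, y (ν i))
      (∑ j, if ν j = a then ∏ i ∈ Finset.univ.erase j, y (ν i) else 0) y
      (EuclideanSpace.single a 1) := by
  unfold HasLineDerivAt
  have h : ∀ i ∈ (Finset.univ : Finset (Fin n)), HasDerivAt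
      (fun t : ℝ => (y + t • EuclideanSpace.single a (1 : ℝ)) (ν i)) (if ν i = a then 1 else 0) 0 := by
    intro i _
    have := ((hasDerivAt_id (0 : ℝ)).mul_const (if ν i = a then (1 : ℝ) else 0)).const_add (y (ν i))
    refine (this.congr_deriv (by simp)).congr_of_eventuallyEq (.of_forall fun t => ?_)
    simp
  refine (HasDerivAt.fun_finsetProd h).congr_deriv ?_
  simp

/-- The moment of a monomial against a Gaussian weight centred at `v`. -/
noncomputable def gaussianMoment {D n : ℕ} (c : ℝ) (v : Space D) (ν : Fin n → Fin D)
    (s : Finset (Fin n)) : ℝ :=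
  ∫ y : Space D, (∏ i ∈ s, y (ν i)) * Real.exp (-c * ‖y - v‖ ^ 2)

theorem integrable_gaussianMoment {D n : ℕ} {c : ℝ} (hc : 0 < c) (v : Space D)
    (ν : Fin n → Fin D) (s : Finset (Fin n)) :
    Integrable fun y : Space D => (∏ i ∈ s, y (ν i)) * Real.exp (-c * ‖y - v‖ ^ 2) :=
  integrable_mul_gaussian hc v (by fun_prop) s.card 1 fun y => by
    simpa using abs_prod_coord_le y ν s

/-- Integration by parts for Gaussian moments. -/
theorem gaussianMoment_cons {D n : ℕ} {c : ℝ} (hc : 0 < c) (v : Space D) (a : Fin D)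
    (ν : Fin n → Fin D) :
    gaussianMoment c v (Fin.cons a ν : Fin (n + 1) → Fin D) Finset.univ =
      v a * gaussianMoment c v ν Finset.univ + (2 * c)⁻¹ *
        ∑ j, if ν j = a then gaussianMoment c v ν (Finset.univ.erase j) else 0 := by
  have i0 := integrable_gaussianMoment hc v ν Finset.univ
  have i1 := integrable_gaussianMoment hc v (Fin.cons a ν : Fin (n + 1) → Fin D) Finset.univ
  have i2 : ∀ j, Integrable fun y : Space D =>
      (if ν j = a then ∏ i ∈ Finset.univ.erase j, y (ν i) else 0) *
        Real.exp (-c * ‖y - v‖ ^ 2) := by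
    intro j
    split_ifs
    · exact integrable_gaussianMoment hc v ν _
    · simp
  simp only [Fin.prod_univ_succ, Fin.cons_zero, Fin.cons_succ] at i1
  -- The a-derivative of the Gaussian brings down -2c (y_a - v_a). Moved onto the monomial, it
  -- removes one factor whose index equals a.
  have hibp := integral_bilinear_hasLineDerivAt_right_eq_neg_left_of_integrable
    (μ := (volume : Measure (Space D))) (B := ContinuousLinearMap.mul ℝ ℝ)
    (f := fun y : Space D => ∏ i, y (ν i))
    (f' := fun y => ∑ j, if ν j = a then ∏ i ∈ Finset.univ.erase j, y (ν i) else 0)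
    (g := fun y : Space D => Real.exp (-c * ‖y - v‖ ^ 2))
    (g' := fun y => -(2 * c) * (y a - v a) * Real.exp (-c * ‖y - v‖ ^ 2))
    (v := EuclideanSpace.single a (1 : ℝ))
    (by simpa [Finset.sum_mul] using integrable_finsetSum _ fun j _ => i2 j)
    (by
      refine ((i1.const_mul (-(2 * c))).add (i0.const_mul (2 * c * v a))).congr
        (.of_forall fun y => ?_)
      simp
      ring)
    (by simpa using i0)
    (fun y _ => hasLineDerivAt_prod_coord ν y a) (fun y _ => hasLineDerivAt_gaussian c v y a)
  simp only [ContinuousLinearMap.mul_apply', Finset.sum_mul] at hibp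
  rw [integral_finsetSum _ fun j _ => i2 j] at hibp
  have e1 : ∀ j, (∫ y : Space D, (if ν j = a then ∏ i ∈ Finset.univ.erase j, y (ν i) else 0) *
      Real.exp (-c * ‖y - v‖ ^ 2)) =
      if ν j = a then gaussianMoment c v ν (Finset.univ.erase j) else 0 := by
    intro j
    split_ifs
    · rfl
    · simp
  have e2 : (∫ y : Space D, (∏ i, y (ν i)) *
      (-(2 * c) * (y a - v a) * Real.exp (-c * ‖y - v‖ ^ 2))) =
      -(2 * c) * gaussianMoment c v (Fin.cons a ν : Fin (n + 1) → Fin D) Finset.univ +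
        2 * c * v a * gaussianMoment c v ν Finset.univ := by
    unfold gaussianMoment
    simp only [Fin.prod_univ_succ, Fin.cons_zero, Fin.cons_succ]
    rw [← integral_const_mul, ← integral_const_mul,
      ← integral_add (i1.const_mul _) (i0.const_mul _)]
    congr 1
    ext y
    ring
  simp only [e1] at hibp
  rw [e2] at hibp
  field_simp
  linarith

/-- Induction on the rank by integration by parts in the first index. The terms pairing it with
another index are traces of T and vanish; the remaining term is v_a times the moments of a slice,
which is again traceless. -/
theorem sum_mul_gaussianMoment {D n : ℕ} {c : ℝ} (hc : 0 < c) (v : Space D)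
    {T : (Fin n → Fin D) → ℝ} (hT : IsTraceless T) :
    ∑ ν, T ν * gaussianMoment c v ν Finset.univ =
      tensorPoly T v * ∫ y : Space D, Real.exp (-c * ‖y - v‖ ^ 2) := by
  induction n with
  | zero => simp [tensorPoly, gaussianMoment]
  | succ n ih =>
    have h0 : ∑ a, ∑ ν, T (Fin.cons a ν) *
        ∑ j, (if ν j = a then gaussianMoment c v ν (Finset.univ.erase j) else 0) = 0 := by
      simp only [Finset.mul_sum, mul_ite, mul_zero]
      rw [Finset.sum_comm]
      have : ∀ ν : Fin n → Fin D, (∑ a, ∑ j, if ν j = a then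
          T (Fin.cons a ν) * gaussianMoment c v ν (Finset.univ.erase j) else 0) =
          ∑ j, T (Fin.cons (ν j) ν) * gaussianMoment c v ν (Finset.univ.erase j) := by
        intro ν
        rw [Finset.sum_comm]
        simp
      simp only [this]
      rw [Finset.sum_comm]
      refine Finset.sum_eq_zero fun j _ => hT.sum_contraction j _ fun ν b => ?_
      unfold gaussianMoment
      congr 1
      ext y
      congr 1
      refine Finset.prod_congr rfl fun i hi => ?_
      rw [Function.update_of_ne (Finset.ne_of_mem_erase hi)]
    rw [sum_cons]
    calc ∑ a, ∑ ν, T (Fin.cons a ν) *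
          gaussianMoment c v (Fin.cons a ν : Fin (n + 1) → Fin D) Finset.univ
        = ∑ a, v a * (∑ ν, T (Fin.cons a ν) * gaussianMoment c v ν Finset.univ) + (2 * c)⁻¹ *
          ∑ a, ∑ ν, T (Fin.cons a ν) *
            ∑ j, (if ν j = a then gaussianMoment c v ν (Finset.univ.erase j) else 0) := by
          rw [Finset.mul_sum, ← Finset.sum_add_distrib]
          refine Finset.sum_congr rfl fun a _ => ?_
          rw [Finset.mul_sum, Finset.mul_sum, ← Finset.sum_add_distrib]
          refine Finset.sum_congr rfl fun ν _ => ?_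
          rw [gaussianMoment_cons hc]
          ring
      _ = _ := by
          rw [h0, mul_zero, add_zero, tensorPoly, sum_cons, Finset.sum_mul]
          refine Finset.sum_congr rfl fun a _ => ?_
          rw [ih (hT.slice a), tensorPoly, ← mul_assoc, Finset.mul_sum]
          congr 1
          refine Finset.sum_congr rfl fun ν _ => ?_
          rw [Fin.prod_univ_succ]
          simp only [Fin.cons_zero, Fin.cons_succ]
          ring

/-- The mean value property of harmonic polynomials for Gaussian weights. -/
theorem integral_tensorPoly_mul_gaussian {D n : ℕ} {c : ℝ} (hc : 0 < c) (v : Space D)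
    {T : (Fin n → Fin D) → ℝ} (hT : IsTraceless T) :
    ∫ y : Space D, tensorPoly T y * Real.exp (-c * ‖y - v‖ ^ 2) =
      (Real.pi / c) ^ ((D : ℝ) / 2) * tensorPoly T v := by
  have h1 : ∫ y : Space D, Real.exp (-c * ‖y - v‖ ^ 2) = (Real.pi / c) ^ ((D : ℝ) / 2) := by
    rw [integral_sub_right_eq_self (fun y : Space D => Real.exp (-c * ‖y‖ ^ 2)) v,
      GaussianFourier.integral_rexp_neg_mul_sq_norm hc]
    simp
  rw [mul_comm, ← h1, ← sum_mul_gaussianMoment hc v hT]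
  simp only [tensorPoly, Finset.sum_mul, gaussianMoment, ← integral_const_mul]
  rw [integral_finsetSum]
  · simp only [mul_assoc]
  · intro ν _
    simpa only [mul_assoc] using (integrable_gaussianMoment hc v ν Finset.univ).const_mul (T ν)

/-! ### Homogeneous polynomials and the traceless projection -/

theorem tensorPoly_smul {D n : ℕ} (T : (Fin n → Fin D) → ℝ) (c : ℝ) (w : Space D) :
    tensorPoly T (c • w) = c ^ n * tensorPoly T w := by
  simp only [tensorPoly, Finset.mul_sum]
  refine Finset.sum_congr rfl fun ν _ => ?_
  simp [Finset.prod_mul_distrib]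
  ring

theorem continuous_tensorPoly {D n : ℕ} (T : (Fin n → Fin D) → ℝ) :
    Continuous (tensorPoly T) := by
  unfold tensorPoly
  fun_prop

theorem abs_tensorPoly_le {D n : ℕ} (T : (Fin n → Fin D) → ℝ) (w : Space D) :
    |tensorPoly T w| ≤ (∑ ν, |T ν|) * ‖w‖ ^ n := by
  rw [tensorPoly, Finset.sum_mul]
  refine (Finset.abs_sum_le_sum_abs _ _).trans (Finset.sum_le_sum fun ν _ => ?_)
  rw [abs_mul]
  gcongr
  simpa using abs_prod_coord_le w ν Finset.univ

/-- The projection is self-adjoint, so it can be moved from the tensor power onto the basis tensor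
at μ. The coefficients are those of the projected basis tensor. -/
theorem exists_tracelessPower_eq_tensorPoly {D n : ℕ} (μ : Fin n → Fin D) :
    ∃ T : (Fin n → Fin D) → ℝ, IsTraceless T ∧
      ∀ w : Space D, tracelessPower w μ = tensorPoly T w := by
  set S := (symTraceless D n).starProjection (EuclideanSpace.single μ (1 : ℝ)) with hS
  refine ⟨S, ((symTraceless D n).starProjection_apply_mem _).2, fun w => ?_⟩
  have h1 : tracelessPower w μ = inner ℝ (EuclideanSpace.single μ (1 : ℝ))
      ((symTraceless D n).starProjection (tensorPower n w)) := by
    rw [EuclideanSpace.inner_single_left]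
    simp [tracelessPower]
  rw [h1, ← Submodule.inner_starProjection_left_eq_right, ← hS, PiLp.inner_apply, tensorPoly]
  refine Finset.sum_congr rfl fun ν _ => ?_
  simp [tensorPower, mul_comm]

/-! ### Convolution of Riesz kernels with a harmonic numerator -/

theorem ae_ne_point {D : ℕ} [Nontrivial (Space D)] (z : Space D) :
    ∀ᵐ w : Space D, w ≠ z :=
  compl_mem_ae_iff.mpr (measure_singleton z)

/-- A majorant with a single singular point. In polar coordinates the part r ≤ ρ needs s < D, since
the second factor is constant there, and the part r > ρ needs s + t > D. -/
theorem integrable_norm_rpow_mul_max_rpow {D : ℕ} [Nontrivial (Space D)] {ρ s t : ℝ}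
    (hρ : 0 < ρ) (hs : s < D) (hst : D < s + t) :
    Integrable fun w : Space D => ‖w‖ ^ (-s) * (max ρ ‖w‖) ^ (-t) := by
  have hD : 1 ≤ D := by
    have := Module.finrank_pos (R := ℝ) (M := Space D)
    simpa [Nat.one_le_iff_ne_zero, Nat.pos_iff_ne_zero] using this
  rw [integrable_fun_norm_addHaar volume (f := fun r : ℝ => r ^ (-s) * (max ρ r) ^ (-t))]
  simp only [finrank_euclideanSpace, Fintype.card_fin, smul_eq_mul]
  rw [← Ioc_union_Ioi_eq_Ioi hρ.le]
  have e : ∀ r : ℝ, 0 < r → r ^ (D - 1) = r ^ ((D : ℝ) - 1) := by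
    intro r hr
    rw [← Real.rpow_natCast, Nat.cast_sub hD, Nat.cast_one]
  refine IntegrableOn.union ?_ ?_
  · have h := ((intervalIntegral.intervalIntegrable_rpow' (a := 0) (b := ρ)
      (r := (D : ℝ) - 1 - s) (by linarith)).const_mul (ρ ^ (-t)))
    rw [intervalIntegrable_iff_integrableOn_Ioc_of_le hρ.le] at h
    refine h.congr_fun (fun r hr => ?_) measurableSet_Ioc
    simp only
    rw [max_eq_left hr.2, e r hr.1, ← mul_assoc, ← Real.rpow_add hr.1]
    ring_nf
  · have h := integrableOn_Ioi_rpow_of_lt (a := (D : ℝ) - 1 - s - t) (by linarith) hρ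
    refine h.congr_fun (fun r hr => ?_) measurableSet_Ioi
    have hr0 : 0 < r := hρ.trans hr
    simp only
    rw [max_eq_right (le_of_lt hr), e r hr0, ← Real.rpow_add hr0, ← Real.rpow_add hr0]
    ring_nf

/-- Absolute convergence of the convolution of two Riesz kernels. -/
theorem integrable_riesz_mul {D : ℕ} {z : Space D} (hz : z ≠ 0) {s t : ℝ}
    (hs : s < D) (ht : t < D) (hst : D < s + t) :
    Integrable fun w : Space D => ‖w - z‖ ^ (-s) * ‖w‖ ^ (-t) := by
  have : Nontrivial (Space D) := ⟨z, 0, hz⟩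
  have hρ : 0 < ‖z‖ / 2 := half_pos (norm_pos_iff.mpr hz)
  have h1 := (integrable_norm_rpow_mul_max_rpow hρ hs hst).comp_sub_right z
  have h2 := integrable_norm_rpow_mul_max_rpow hρ ht (by linarith : (D : ℝ) < t + s)
  refine (h1.add h2).mono' ?_ (.of_forall fun w => ?_)
  · refine Measurable.aestronglyMeasurable ?_
    exact ((measurable_id.sub_const z).norm.pow_const _).mul (measurable_norm.pow_const _)
  -- The larger of the two distances is at least ‖z‖/2 and at least the smaller one. As s and t are
  -- positive, its factor is bounded by the `max` factor built on the smaller distance.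
  · have tri : ‖z‖ ≤ ‖w - z‖ + ‖w‖ := by
      have := norm_sub_le w (w - z)
      simp only [sub_sub_cancel] at this
      linarith
    have n1 : 0 ≤ ‖w - z‖ ^ (-s) * (max (‖z‖ / 2) ‖w - z‖) ^ (-t) := by positivity
    have n2 : 0 ≤ ‖w‖ ^ (-t) * (max (‖z‖ / 2) ‖w‖) ^ (-s) := by positivity
    rw [Real.norm_of_nonneg (by positivity)]
    simp only [Pi.add_apply]
    rcases le_total ‖w - z‖ ‖w‖ with h | h
    · have : ‖w‖ ^ (-t) ≤ (max (‖z‖ / 2) ‖w - z‖) ^ (-t) :=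
        Real.rpow_le_rpow_of_nonpos (lt_max_of_lt_left hρ) (max_le (by linarith) h) (by linarith)
      have := mul_le_mul_of_nonneg_left this (Real.rpow_nonneg (norm_nonneg (w - z)) (-s))
      linarith
    · have : ‖w - z‖ ^ (-s) ≤ (max (‖z‖ / 2) ‖w‖) ^ (-s) :=
        Real.rpow_le_rpow_of_nonpos (lt_max_of_lt_left hρ) (max_le (by linarith) h) (by linarith)
      have := mul_le_mul_of_nonneg_right this (Real.rpow_nonneg (norm_nonneg w) (-t))
      linarith

/-- Integrating the norm over (c, t) first, with |H(w)| ≤ C ‖w‖^n, leaves a product of Riesz kernels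
with exponents 2 Re α and 2 Re β - n. The three hypotheses are exactly its convergence conditions.
-/
theorem integrable_tensorPoly_mul_schwinger {D n : ℕ} {z : Space D} (hz : z ≠ 0)
    (T : (Fin n → Fin D) → ℝ) {α β : ℂ} (hα : 2 * α.re < D) (hβ : 2 * β.re < D + n) (hαβ : D + n < 2 * (α.re + β.re)) :
    Integrable (fun p : Space D × (ℝ × ℝ) =>
      (tensorPoly T p.1 : ℂ) * schwinger α β (‖p.1 - z‖ ^ 2) (‖p.1‖ ^ 2) p.2)
      (volume.prod quadrant) := by
  have : Nontrivial (Space D) := ⟨z, 0, hz⟩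
  have hα0 : 0 < α.re := by linarith
  have hβ' : 0 < β.re := by
    have : (0 : ℝ) ≤ n := n.cast_nonneg
    linarith
  have hH : Measurable fun p : Space D × (ℝ × ℝ) => (tensorPoly T p.1 : ℂ) :=
    Complex.measurable_ofReal.comp ((continuous_tensorPoly T).measurable.comp measurable_fst)
  have hm : Measurable (fun p : Space D × (ℝ × ℝ) =>
      (tensorPoly T p.1 : ℂ) * schwinger α β (‖p.1 - z‖ ^ 2) (‖p.1‖ ^ 2) p.2) :=
    hH.mul (measurable_schwinger α β (by fun_prop) (by fun_prop) measurable_snd)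
  rw [integrable_prod_iff hm.aestronglyMeasurable]
  constructor
  · filter_upwards [ae_ne_point z, ae_ne_point 0] with w hwz hw
    have h1 : 0 < ‖w - z‖ := norm_pos_iff.mpr (sub_ne_zero.mpr hwz)
    have h2 : 0 < ‖w‖ := norm_pos_iff.mpr hw
    exact (integrable_schwinger hα0 hβ' (by positivity) (by positivity)).const_mul _
  · have h := (integrable_riesz_mul hz (s := 2 * α.re) (t := 2 * β.re - n) hα
      (by linarith) (by linarith)).const_mul
      (Real.Gamma α.re * Real.Gamma β.re * ∑ ν, |T ν|)
    refine h.mono' (hm.norm.stronglyMeasurable.integral_prod_right).aestronglyMeasurable ?_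
    filter_upwards [ae_ne_point z, ae_ne_point 0] with w hwz hw
    have h1 : 0 < ‖w - z‖ := norm_pos_iff.mpr (sub_ne_zero.mpr hwz)
    have h2 : 0 < ‖w‖ := norm_pos_iff.mpr hw
    simp only [norm_mul, Complex.norm_real, Real.norm_eq_abs]
    rw [integral_const_mul, integral_norm_schwinger hα0 hβ' (by positivity) (by positivity),
      abs_of_nonneg (by
        have := Real.Gamma_pos_of_pos hα0
        have := Real.Gamma_pos_of_pos hβ'
        positivity)]
    have e1 : (‖w - z‖ ^ 2) ^ (-α.re) = ‖w - z‖ ^ (-(2 * α.re)) := by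
      rw [← Real.rpow_natCast, ← Real.rpow_mul h1.le]; push_cast; ring_nf
    have e2 : ‖w‖ ^ n * (‖w‖ ^ 2) ^ (-β.re) = ‖w‖ ^ (-(2 * β.re - n)) := by
      rw [← Real.rpow_natCast, ← Real.rpow_natCast, ← Real.rpow_mul h2.le, ← Real.rpow_add h2]
      push_cast; ring_nf
    have := Real.Gamma_pos_of_pos hα0
    have := Real.Gamma_pos_of_pos hβ'
    rw [← e2, e1]
    calc |tensorPoly T w| * (Real.Gamma α.re * Real.Gamma β.re *
          (‖w - z‖ ^ (-(2 * α.re)) * (‖w‖ ^ 2) ^ (-β.re)))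
        ≤ ((∑ ν, |T ν|) * ‖w‖ ^ n) * (Real.Gamma α.re * Real.Gamma β.re *
          (‖w - z‖ ^ (-(2 * α.re)) * (‖w‖ ^ 2) ^ (-β.re))) := by
          gcongr
          exact abs_tensorPoly_le T w
      _ = _ := by ring

theorem gaussian_exponent_identity {D : ℕ} (z w : Space D) {c t : ℝ} (hc : 0 < c) :
    -((‖w - z‖ ^ 2 + c * ‖w‖ ^ 2) * t) =
      -(t * (1 + c)) * ‖w - (1 + c)⁻¹ • z‖ ^ 2 + -(‖z‖ ^ 2 * (c / (1 + c)) * t) := by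
  have h : 1 + c ≠ 0 := by positivity
  rw [norm_sub_sq_real, norm_sub_sq_real, inner_smul_right, norm_smul, Real.norm_eq_abs, mul_pow,
    sq_abs]
  field_simp
  ring

/-- Completing the square gives a Gaussian of rate t(1 + c) centred at z/(1 + c). The mean value
property yields H(z/(1 + c)) = (1 + c)^(-n) H(z), whence the n in the exponent of 1 + c. -/
theorem integral_tensorPoly_mul_schwinger {D n : ℕ} (z : Space D) {T : (Fin n → Fin D) → ℝ}
    (hT : IsTraceless T) (α β : ℂ) {c t : ℝ} (hc : 0 < c) (ht : 0 < t) :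
    ∫ w : Space D, (tensorPoly T w : ℂ) * schwinger α β (‖w - z‖ ^ 2) (‖w‖ ^ 2) (c, t) =
      ((Real.pi : ℂ) ^ ((D : ℂ) / 2) * tensorPoly T z * ((c : ℂ) ^ (β - 1) *
        ((1 + c : ℝ) : ℂ) ^ (-((D : ℂ) / 2 + n)))) *
        ((t : ℂ) ^ ((α + β - D / 2) - 1) *
          Complex.exp (-((‖z‖ ^ 2 * (c / (1 + c)) : ℝ) * (t : ℂ)))) := by
  have h1 : 0 < 1 + c := by positivity
  have e : ∀ w : Space D, (tensorPoly T w : ℂ) *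
      schwinger α β (‖w - z‖ ^ 2) (‖w‖ ^ 2) (c, t) =
      ((c : ℂ) ^ (β - 1) * (t : ℂ) ^ (α + β - 1) *
        Complex.exp (-((‖z‖ ^ 2 * (c / (1 + c)) : ℝ) * (t : ℂ)))) *
      ((tensorPoly T w * Real.exp (-(t * (1 + c)) * ‖w - (1 + c)⁻¹ • z‖ ^ 2) : ℝ) : ℂ) := by
    intro w
    have := gaussian_exponent_identity z w (t := t) hc
    simp only [schwinger]
    rw [← Complex.ofReal_mul, ← Complex.ofReal_neg, this, ← Complex.ofReal_exp, Real.exp_add]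
    push_cast
    ring
  simp only [e]
  rw [integral_const_mul, integral_complex_ofReal, integral_tensorPoly_mul_gaussian (by positivity)
    _ hT, tensorPoly_smul, Complex.ofReal_mul ((Real.pi / (t * (1 + c))) ^ ((D : ℝ) / 2)),
    Complex.ofReal_cpow (by positivity),
    ofReal_cpow_eq_exp hc, ofReal_cpow_eq_exp ht, ofReal_cpow_eq_exp ht,
    ofReal_cpow_eq_exp h1, ofReal_cpow_eq_exp Real.pi_pos, ofReal_cpow_eq_exp (by positivity),
    Complex.ofReal_mul ((1 + c)⁻¹ ^ n)]
  have e2 : (((1 + c)⁻¹ ^ n : ℝ) : ℂ) = Complex.exp (-(n * Real.log (1 + c))) := by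
    rw [Complex.exp_neg, Complex.exp_nat_mul, ← Complex.ofReal_exp, Real.exp_log h1]
    push_cast
    rw [inv_pow]
  rw [e2, Real.log_div Real.pi_pos.ne' (by positivity), Real.log_mul ht.ne' h1.ne']
  have e3 : Complex.exp (Real.log c * (β - 1)) * Complex.exp (Real.log t * (α + β - 1)) *
      Complex.exp (((Real.log Real.pi - (Real.log t + Real.log (1 + c)) : ℝ) : ℂ) *
        (((D : ℝ) / 2 : ℝ) : ℂ)) * Complex.exp (-(n * Real.log (1 + c))) =
      Complex.exp (Real.log Real.pi * ((D : ℂ) / 2)) * (Complex.exp (Real.log c * (β - 1)) *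
        Complex.exp (Real.log (1 + c) * (-((D : ℂ) / 2 + n)))) *
        Complex.exp (Real.log t * ((α + β - D / 2) - 1)) := by
    simp only [← Complex.exp_add]
    congr 1
    push_cast
    ring
  linear_combination (Complex.exp (-((‖z‖ ^ 2 * (c / (1 + c)) : ℝ) * (t : ℂ))) *
    (tensorPoly T z : ℂ)) * e3

/-- The t-integral is Γ(α + β - D/2) times a power of ‖z‖² c/(1 + c). The remaining c-integral is
the Beta integral with p = D/2 - α and q = D/2 - β + n. -/
theorem integral_quadrant_tensorPoly_mul_schwinger {D n : ℕ} {z : Space D} (hz : z ≠ 0)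
    {T : (Fin n → Fin D) → ℝ} (hT : IsTraceless T) {α β : ℂ} (hα : 2 * α.re < D)
    (hβ : 2 * β.re < D + n)
    (hαβ : D + n < 2 * (α.re + β.re)) :
    ∫ r, (∫ w : Space D, (tensorPoly T w : ℂ) * schwinger α β (‖w - z‖ ^ 2) (‖w‖ ^ 2) r) ∂quadrant
      = (Real.pi : ℂ) ^ ((D : ℂ) / 2) * Complex.Gamma (α + β - D / 2) *
        (Complex.Gamma (D / 2 - α) * Complex.Gamma (D / 2 - β + n) /
          Complex.Gamma (D - α - β + n)) *
        ((‖z‖ ^ 2 : ℝ) : ℂ) ^ (-(α + β - D / 2)) * tensorPoly T z := by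
  have hn : (0 : ℝ) ≤ n := n.cast_nonneg
  have hσ : 0 < (α + β - D / 2).re := by simp; linarith
  have hp : 0 < ((D : ℂ) / 2 - α).re := by simp; linarith
  have hq : 0 < ((D : ℂ) / 2 - β + n).re := by simp; linarith
  have hz0 : 0 < ‖z‖ ^ 2 := by have := norm_pos_iff.mpr hz; positivity
  have hF := (integrable_tensorPoly_mul_schwinger hz T hα hβ hαβ).integral_prod_right
  unfold quadrant at hF ⊢
  rw [integral_prod _ hF]
  have e : ∀ c ∈ Ioi (0 : ℝ), (∫ t in Ioi (0 : ℝ), ∫ w : Space D, (tensorPoly T w : ℂ) *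
      schwinger α β (‖w - z‖ ^ 2) (‖w‖ ^ 2) (c, t)) =
      ((Real.pi : ℂ) ^ ((D : ℂ) / 2) * tensorPoly T z * Complex.Gamma (α + β - D / 2) *
        ((‖z‖ ^ 2 : ℝ) : ℂ) ^ (-(α + β - D / 2))) *
      ((c : ℂ) ^ (((D : ℂ) / 2 - α) - 1) *
        ((1 + c * 1 : ℝ) : ℂ) ^ (-((D / 2 - α) + (D / 2 - β + n)))) := by
    intro c hc
    have hc0 : 0 < c := hc
    have h1 : 0 < 1 + c := by positivity
    have hm : 0 < ‖z‖ ^ 2 * (c / (1 + c)) := by positivity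
    rw [setIntegral_congr_fun measurableSet_Ioi
      (fun t ht => integral_tensorPoly_mul_schwinger z hT α β hc0 ht), integral_const_mul,
      Complex.integral_cpow_mul_exp_neg_mul_Ioi hσ hm, mul_one, ← Complex.ofReal_one,
      ← Complex.ofReal_div, ofReal_cpow_eq_exp hc0, ofReal_cpow_eq_exp hc0, ofReal_cpow_eq_exp h1,
      ofReal_cpow_eq_exp h1, ofReal_cpow_eq_exp hz0, ofReal_cpow_eq_exp (one_div_pos.mpr hm), one_div,
      Real.log_inv, Real.log_mul hz0.ne' (by positivity), Real.log_div hc0.ne' h1.ne']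
    have e3 : Complex.exp (Real.log c * (β - 1)) *
        Complex.exp (Real.log (1 + c) * (-((D : ℂ) / 2 + n))) *
        Complex.exp (((-(Real.log (‖z‖ ^ 2) + (Real.log c - Real.log (1 + c))) : ℝ) : ℂ) *
          (α + β - D / 2)) =
        Complex.exp (Real.log (‖z‖ ^ 2) * -(α + β - D / 2)) *
        (Complex.exp (Real.log c * (((D : ℂ) / 2 - α) - 1)) *
        Complex.exp (Real.log (1 + c) * (-((D / 2 - α) + (D / 2 - β + n))))) := by
      simp only [← Complex.exp_add]
      congr 1
      push_cast
      ring
    linear_combination ((Real.pi : ℂ) ^ ((D : ℂ) / 2) * tensorPoly T z *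
      Complex.Gamma (α + β - D / 2)) * e3
  rw [setIntegral_congr_fun measurableSet_Ioi e, integral_const_mul,
    integral_beta hp hq one_pos one_pos]
  simp only [Complex.ofReal_one, Complex.one_cpow]
  rw [show (D : ℂ) / 2 - α + (D / 2 - β + n) = D - α - β + n by ring]
  ring

/-- Convolution of a Riesz kernel with a harmonic polynomial times a power of the norm: absolute
convergence and value. -/
theorem riesz_convolution {D n : ℕ} {z : Space D} (hz : z ≠ 0)
    {T : (Fin n → Fin D) → ℝ} (hT : IsTraceless T) {α β : ℂ} (hα : 2 * α.re < D)
    (hβ : 2 * β.re < D + n)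
    (hαβ : D + n < 2 * (α.re + β.re)) :
    Integrable (fun w : Space D =>
      normPow (w - z) (-(2 * α)) * normPow w (-(2 * β)) * (tensorPoly T w : ℂ)) ∧
    ∫ w : Space D, normPow (w - z) (-(2 * α)) * normPow w (-(2 * β)) * (tensorPoly T w : ℂ) =
      (Real.pi : ℂ) ^ ((D : ℂ) / 2) * Complex.Gamma (α + β - D / 2) *
        Complex.Gamma (D / 2 - α) * Complex.Gamma (D / 2 - β + n) /
          (Complex.Gamma α * Complex.Gamma β * Complex.Gamma (D - α - β + n)) *
        normPow z (D - 2 * α - 2 * β) * tensorPoly T z := by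
  have : Nontrivial (Space D) := ⟨z, 0, hz⟩
  have hα0 : 0 < α.re := by linarith
  have hβ' : 0 < β.re := by
    have : (0 : ℝ) ≤ n := n.cast_nonneg
    linarith
  have gα := Complex.Gamma_ne_zero_of_re_pos hα0
  have gβ := Complex.Gamma_ne_zero_of_re_pos hβ'
  have sq : ∀ {r : ℝ} (_ : 0 < r) (s : ℂ), ((r ^ 2 : ℝ) : ℂ) ^ s = (r : ℂ) ^ (2 * s) := by
    intro r hr s
    rw [ofReal_cpow_eq_exp (by positivity), ofReal_cpow_eq_exp hr, Real.log_pow]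
    congr 1
    push_cast
    ring
  have hF := integrable_tensorPoly_mul_schwinger hz T hα hβ hαβ
  have e : ∀ᵐ w : Space D, (∫ r, (tensorPoly T w : ℂ) *
      schwinger α β (‖w - z‖ ^ 2) (‖w‖ ^ 2) r ∂quadrant) =
      (Complex.Gamma α * Complex.Gamma β) *
      (normPow (w - z) (-(2 * α)) * normPow w (-(2 * β)) * (tensorPoly T w : ℂ)) := by
    filter_upwards [ae_ne_point z, ae_ne_point 0] with w hwz hw
    have h1 : 0 < ‖w - z‖ := norm_pos_iff.mpr (sub_ne_zero.mpr hwz)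
    have h2 : 0 < ‖w‖ := norm_pos_iff.mpr hw
    rw [integral_const_mul, integral_schwinger hα0 hβ' (by positivity) (by positivity), sq h1,
      sq h2, normPow, normPow, mul_neg, mul_neg]
    ring
  constructor
  · have h := (hF.integral_prod_left.congr e).const_mul (Complex.Gamma α * Complex.Gamma β)⁻¹
    simpa [← mul_assoc, gα, gβ] using h
  · have h := integral_integral_swap (f := fun (w : Space D) (r : ℝ × ℝ) => (tensorPoly T w : ℂ) *
      schwinger α β (‖w - z‖ ^ 2) (‖w‖ ^ 2) r) hF
    rw [integral_congr_ae e, integral_const_mul,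
      integral_quadrant_tensorPoly_mul_schwinger hz hT hα hβ hαβ,
      sq (norm_pos_iff.mpr hz)] at h
    rw [← mul_right_inj' (mul_ne_zero gα gβ), h, normPow]
    rw [show 2 * -(α + β - (D : ℂ) / 2) = D - 2 * α - 2 * β by ring]
    field_simp

/-! ### Inversion and its change of variables -/

theorem inversion_eq {D : ℕ} (v : Space D) : inversion v = EuclideanGeometry.inversion 0 1 v := by
  simp [inversion, EuclideanGeometry.inversion]

theorem inversion_inversion {D : ℕ} (v : Space D) : inversion (inversion v) = v := by
  rw [inversion_eq, inversion_eq, EuclideanGeometry.inversion_inversion _ one_ne_zero]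

theorem inversion_zero {D : ℕ} : inversion (0 : Space D) = 0 := by simp [inversion]

theorem inversion_neg {D : ℕ} (v : Space D) : inversion (-v) = -inversion v := by simp [inversion]

theorem inversion_ne_zero {D : ℕ} {v : Space D} (hv : v ≠ 0) : inversion v ≠ 0 := by
  intro h
  apply hv
  rw [← inversion_inversion v, h, inversion_zero]

theorem norm_inversion {D : ℕ} (v : Space D) : ‖inversion v‖ = ‖v‖⁻¹ := by
  have := EuclideanGeometry.dist_inversion_center (0 : Space D) v 1
  rw [← inversion_eq] at this
  simpa using this

theorem norm_inversion_sub {D : ℕ} {v w : Space D} (hv : v ≠ 0) (hw : w ≠ 0) :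
    ‖inversion v - inversion w‖ = ‖v - w‖ / (‖v‖ * ‖w‖) := by
  have := EuclideanGeometry.dist_inversion_inversion hv hw 1
  rw [← inversion_eq, ← inversion_eq, dist_zero_right, dist_zero_right,
    dist_eq_norm, dist_eq_norm] at this
  rw [this]
  ring

/-- The derivative is ‖w‖^(-2) times a reflection, whose determinant is ±1. -/
theorem abs_det_inversion {D : ℕ} (w : Space D) :
    |((1 / dist w 0) ^ 2 • ((ℝ ∙ (w - 0))ᗮ.reflection : Space D →L[ℝ] Space D)).det| =
      (‖w‖ ^ (2 * D))⁻¹ := by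
  have h : ((ℝ ∙ (w - 0))ᗮ.reflection : Space D →L[ℝ] Space D).det =
      (-1) ^ Module.finrank ℝ ((ℝ ∙ (w - 0))ᗮᗮ : Submodule ℝ (Space D)) :=
    Submodule.det_reflection _
  unfold ContinuousLinearMap.det at h ⊢
  rw [ContinuousLinearMap.toLinearMap_smul, LinearMap.det_smul, h, abs_mul, abs_pow (-1 : ℝ)]
  simp [pow_mul]

theorem image_inversion {D : ℕ} :
    inversion '' {(0 : Space D)}ᶜ = {0}ᶜ := by
  ext v
  simp only [mem_image, mem_compl_iff, mem_singleton_iff]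
  constructor
  · rintro ⟨w, hw, rfl⟩
    exact inversion_ne_zero hw
  · exact fun hv => ⟨inversion v, inversion_ne_zero hv, inversion_inversion v⟩

theorem restrict_compl_zero {D : ℕ} [Nontrivial (Space D)] :
    (volume : Measure (Space D)).restrict {0}ᶜ = volume :=
  Measure.restrict_eq_self_of_ae_mem (ae_ne_point 0)

/-- Change of variables under the inversion: integrability. -/
theorem integrable_inversion_iff {D : ℕ} [Nontrivial (Space D)] (g : Space D → ℂ) :
    Integrable g ↔ Integrable fun w : Space D => (‖w‖ ^ (2 * D))⁻¹ • g (inversion w) := by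
  have h := integrableOn_image_iff_integrableOn_abs_det_fderiv_smul
    (volume : Measure (Space D)) (measurableSet_singleton (0 : Space D)).compl
    (fun w hw => (EuclideanGeometry.hasFDerivAt_inversion (R := 1) (c := (0 : Space D))
      hw).hasFDerivWithinAt)
    (EuclideanGeometry.inversion_injective _ one_ne_zero).injOn g
  have e : EuclideanGeometry.inversion (0 : Space D) 1 = inversion :=
    funext fun v => (inversion_eq v).symm
  simpa only [e, image_inversion, IntegrableOn, restrict_compl_zero, abs_det_inversion] using h

/-- Change of variables under the inversion. -/
theorem integral_inversion {D : ℕ} [Nontrivial (Space D)] (g : Space D → ℂ) :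
    ∫ y, g y = ∫ w : Space D, (‖w‖ ^ (2 * D))⁻¹ • g (inversion w) := by
  have h := integral_image_eq_integral_abs_det_fderiv_smul
    (volume : Measure (Space D)) (measurableSet_singleton (0 : Space D)).compl
    (fun w hw => (EuclideanGeometry.hasFDerivAt_inversion (R := 1) (c := (0 : Space D))
      hw).hasFDerivWithinAt)
    (EuclideanGeometry.inversion_injective _ one_ne_zero).injOn g
  have e : EuclideanGeometry.inversion (0 : Space D) 1 = inversion :=
    funext fun v => (inversion_eq v).symm
  simpa only [e, image_inversion, restrict_compl_zero, abs_det_inversion] using h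

/-! ### The star-triangle relation in inverted coordinates -/

theorem normPow_eq_exp {D : ℕ} {v : Space D} (hv : v ≠ 0) (s : ℂ) :
    normPow v s = Complex.exp (Real.log ‖v‖ * s) :=
  ofReal_cpow_eq_exp (norm_pos_iff.mpr hv) s

theorem log_norm_inversion_sub {D : ℕ} {v w : Space D} (hv : v ≠ 0) (hw : w ≠ 0) (hvw : v ≠ w) :
    Real.log ‖inversion v - inversion w‖ =
      Real.log ‖v - w‖ - Real.log ‖v‖ - Real.log ‖w‖ := by
  have h1 := norm_ne_zero_iff.mpr hv
  have h2 := norm_ne_zero_iff.mpr hw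
  have h3 := norm_ne_zero_iff.mpr (sub_ne_zero.mpr hvw)
  rw [norm_inversion_sub hv hw, Real.log_div h3 (mul_ne_zero h1 h2), Real.log_mul h1 h2]
  ring

theorem tensorPoly_neg {D n : ℕ} (T : (Fin n → Fin D) → ℝ) (w : Space D) :
    tensorPoly T (-w) = (-1) ^ n * tensorPoly T w := by
  rw [← tensorPoly_smul, neg_one_smul]

/-- The conformal triangle in inverted coordinates centred at its third point. -/
theorem triangle_inversion {D n : ℕ} {μ : Fin n → Fin D} {T : (Fin n → Fin D) → ℝ}
    (hT : ∀ w : Space D, tracelessPower w μ = tensorPoly T w) (Δ₁ Δ₂ Δ : ℂ) (x : Space D)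
    {v w : Space D} (hv : v ≠ 0) (hw : w ≠ 0) (hvw : v ≠ w) :
    triangle Δ₁ Δ₂ Δ μ x (x + inversion v) (x + inversion w) =
      (-1) ^ n * (tensorPoly T (v - w) : ℂ) * Complex.exp
        (-((Real.log ‖v - w‖ - Real.log ‖v‖ - Real.log ‖w‖) * (Δ₁ + Δ₂ - Δ + n)) +
          Real.log ‖v‖ * (Δ₁ - Δ₂ + Δ - n) + Real.log ‖w‖ * (Δ₂ - Δ₁ + Δ - n)) := by
  have h1 : inversion v - inversion w ≠ 0 := by
    refine sub_ne_zero.mpr fun h => hvw ?_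
    rw [← inversion_inversion v, h, inversion_inversion]
  have h2 := neg_ne_zero.mpr (inversion_ne_zero hv)
  have h3 := neg_ne_zero.mpr (inversion_ne_zero hw)
  -- Here x - x₁ = -`inversion v`, whose inversion is -v. The tensor argument is therefore -(v - w),
  -- the source of (-1)^n.
  simp only [triangle, sub_add_cancel_left, add_sub_add_left_eq_sub]
  rw [inversion_neg, inversion_neg, inversion_inversion, inversion_inversion, hT,
    show -v - -w = -(v - w) by abel, tensorPoly_neg, normPow_eq_exp h1, normPow_eq_exp h2,
    normPow_eq_exp h3, log_norm_inversion_sub hv hw hvw, norm_neg, norm_neg, norm_inversion,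
    norm_inversion, Real.log_inv, Real.log_inv, ← Complex.exp_add, ← Complex.exp_add,
    div_eq_mul_inv, ← Complex.exp_neg]
  push_cast
  congr 2
  ring

theorem exists_eq_add_inversion {D : ℕ} {x y : Space D} (h : y ≠ x) :
    ∃ w : Space D, w ≠ 0 ∧ y = x + inversion w :=
  ⟨inversion (y - x), inversion_ne_zero (sub_ne_zero.mpr h), by rw [inversion_inversion]; abel⟩

/-- The integrand of `Q(u)` on the conformal triangle. -/
noncomputable def qIntegrand {D n : ℕ} (Δ₁ Δ₂ Δ u : ℂ) (μ : Fin n → Fin D) (x x₁ x₂ y : Space D) :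
    ℂ :=
  pKernel (u + (Δ₂ - Δ₁) / 2) x₁ y *
    q₁₂ (u + (Δ₁ + Δ₂ - D) / 2) (triangle Δ₁ Δ₂ Δ μ x) y x₂

/-- The exponents of ‖w‖ from the kernel, the power of the distance, the triangle and the Jacobian
add up to zero, so only the singular points w₁ and w₂ survive. Writing w - w₁ as (w - w₂) - (w₁ -
w₂) exhibits the convolution after a shift by w₂. -/
theorem qIntegrand_inversion {D n : ℕ} {μ : Fin n → Fin D} {T : (Fin n → Fin D) → ℝ}
    (hT : ∀ w : Space D, tracelessPower w μ = tensorPoly T w) (Δ₁ Δ₂ Δ u : ℂ) (x : Space D)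
    {w₁ w₂ w : Space D} (hw₁ : w₁ ≠ 0) (hw₂ : w₂ ≠ 0) (hw : w ≠ 0) (h₁ : w ≠ w₁) (h₂ : w ≠ w₂) :
    (‖w‖ ^ (2 * D))⁻¹ •
      qIntegrand Δ₁ Δ₂ Δ u μ x (x + inversion w₁) (x + inversion w₂) (x + inversion w) =
      ((-1) ^ n * Complex.exp (Real.log ‖w₁‖ * (D - 2 * kappa Δ₁ Δ₂ u) +
        Real.log ‖w₂‖ * (D + Δ₂ - Δ₁ - 2 * u))) *
      (normPow ((w - w₂) - (w₁ - w₂)) (-(2 * (D / 2 - kappa Δ₁ Δ₂ u))) *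
        normPow (w - w₂) (-(2 * ((D + n - Δ) / 2 - u))) * (tensorPoly T (w - w₂) : ℂ)) := by
  have e1 : inversion w₁ - inversion w ≠ 0 := by
    refine sub_ne_zero.mpr fun h => h₁ ?_
    rw [← inversion_inversion w, ← h, inversion_inversion]
  have e2 : inversion w - inversion w₂ ≠ 0 := by
    refine sub_ne_zero.mpr fun h => h₂ ?_
    rw [← inversion_inversion w, h, inversion_inversion]
  have e3 : (((‖w‖ ^ (2 * D))⁻¹ : ℝ) : ℂ) = Complex.exp (-(2 * D * Real.log ‖w‖)) := by
    have := norm_pos_iff.mpr hw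
    rw [Complex.exp_neg, ← Nat.cast_ofNat (R := ℂ), ← Nat.cast_mul, Complex.exp_nat_mul,
      ← Complex.ofReal_exp, Real.exp_log this]
    push_cast
    rfl
  rw [qIntegrand, q₁₂, triangle_inversion hT _ _ _ _ hw hw₂ h₂, pKernel, Complex.real_smul, e3,
    add_sub_add_left_eq_sub, add_sub_add_left_eq_sub, sub_sub_sub_cancel_right,
    normPow_eq_exp e1, normPow_eq_exp e2, normPow_eq_exp (sub_ne_zero.mpr h₁),
    normPow_eq_exp (sub_ne_zero.mpr h₂), log_norm_inversion_sub hw₁ hw h₁.symm,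
    log_norm_inversion_sub hw hw₂ h₂, norm_sub_rev w₁ w]
  have e4 : Complex.exp (-(2 * D * Real.log ‖w‖)) *
      (Complex.exp (((Real.log ‖w - w₁‖ - Real.log ‖w₁‖ - Real.log ‖w‖ : ℝ) : ℂ) *
        (-(D + 2 * (u + (Δ₂ - Δ₁) / 2)))) *
      (Complex.exp (((Real.log ‖w - w₂‖ - Real.log ‖w‖ - Real.log ‖w₂‖ : ℝ) : ℂ) *
        (2 * (u + (Δ₁ + Δ₂ - D) / 2))) * Complex.exp
        (-((Real.log ‖w - w₂‖ - Real.log ‖w‖ - Real.log ‖w₂‖) * (Δ₁ + Δ₂ - Δ + n)) +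
          Real.log ‖w‖ * (Δ₁ - Δ₂ + Δ - n) + Real.log ‖w₂‖ * (Δ₂ - Δ₁ + Δ - n)))) =
      Complex.exp (Real.log ‖w₁‖ * (D - 2 * kappa Δ₁ Δ₂ u) +
        Real.log ‖w₂‖ * (D + Δ₂ - Δ₁ - 2 * u)) *
      (Complex.exp (Real.log ‖w - w₁‖ * (-(2 * (D / 2 - kappa Δ₁ Δ₂ u)))) *
        Complex.exp (Real.log ‖w - w₂‖ * (-(2 * ((D + n - Δ) / 2 - u))))) := by
    simp only [← Complex.exp_add, kappa]
    congr 1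
    push_cast
    ring
  linear_combination ((-1) ^ n * (tensorPoly T (w - w₂) : ℂ)) * e4

/-- The star-triangle relation: convergence and value of the integral in `Q(u)` on the conformal
triangle. -/
theorem integral_qIntegrand {D n : ℕ} (μ : Fin n → Fin D) {x₁ x₂ x : Space D}
    (h₁₂ : x₁ ≠ x₂) (h₁ : x₁ ≠ x) (h₂ : x₂ ≠ x) {Δ₁ Δ₂ Δ u : ℂ}
    (hP : (Δ₁, Δ₂, Δ, u) ∈ QTube D) :
    Integrable (qIntegrand Δ₁ Δ₂ Δ u μ x x₁ x₂) ∧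
    normPow (x₁ - x₂) (2 * ((D : ℂ) / 2 - Δ₁)) * ∫ y, qIntegrand Δ₁ Δ₂ Δ u μ x x₁ x₂ y =
      tau D ((D : ℂ) / 2 - delta n Δ₁ Δ₂ Δ) (kappa Δ₁ Δ₂ u) n *
        triangle ((Δ₁ + Δ₂) / 2 + u) ((Δ₁ + Δ₂) / 2 - u) Δ μ x x₁ x₂ := by
  have : Nontrivial (Space D) := ⟨x₁, x₂, h₁₂⟩
  obtain ⟨T, hTt, hT⟩ := exists_tracelessPower_eq_tensorPoly μ
  obtain ⟨w₁, hw₁, rfl⟩ := exists_eq_add_inversion h₁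
  obtain ⟨w₂, hw₂, rfl⟩ := exists_eq_add_inversion h₂
  have hw : w₁ ≠ w₂ := by rintro rfl; exact h₁₂ rfl
  obtain ⟨hk, hu, hd⟩ := hP
  simp only [Complex.sub_re, Complex.add_re, Complex.mul_re, Complex.re_ofNat, Complex.im_ofNat,
    zero_mul, sub_zero, kappa, Complex.div_ofNat_re] at hk hu hd
  -- With these α and β the three convergence conditions are, in order, Re κ > 0, Re(Δ + 2u) > 0 and
  -- Re(Δ₁ - Δ₂ + Δ) < D.
  obtain ⟨hi, hv⟩ := riesz_convolution (sub_ne_zero.mpr hw) hTt (α := (D : ℂ) / 2 - kappa Δ₁ Δ₂ u)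
    (β := (D + n - Δ) / 2 - u)
    (by simp [kappa]; linarith) (by simp; linarith) (by simp [kappa]; linarith)
  have key := ((ae_ne_point (0 : Space D)).and ((ae_ne_point w₁).and (ae_ne_point w₂))).mono
    fun w a => qIntegrand_inversion hT Δ₁ Δ₂ Δ u x hw₁ hw₂ a.1 a.2.1 a.2.2
  constructor
  · have h := ((hi.comp_sub_right w₂).const_mul
      ((-1) ^ n * Complex.exp (Real.log ‖w₁‖ * (D - 2 * kappa Δ₁ Δ₂ u) +
        Real.log ‖w₂‖ * (D + Δ₂ - Δ₁ - 2 * u)))).congr (key.mono fun w hw => hw.symm)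
    have h' := ((integrable_inversion_iff fun y => qIntegrand Δ₁ Δ₂ Δ u μ x (x + inversion w₁)
      (x + inversion w₂) (x + y)).mpr h).comp_sub_right x
    simpa using h'
  · rw [← integral_add_left_eq_self (fun y => qIntegrand Δ₁ Δ₂ Δ u μ x (x + inversion w₁)
      (x + inversion w₂) y) x, integral_inversion, integral_congr_ae key, integral_const_mul,
      integral_sub_right_eq_self (fun w : Space D =>
        normPow (w - (w₁ - w₂)) (-(2 * (D / 2 - kappa Δ₁ Δ₂ u))) *
          normPow w (-(2 * ((D + n - Δ) / 2 - u))) * (tensorPoly T w : ℂ)) w₂, hv,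
      triangle_inversion hT _ _ _ _ hw₁ hw₂ hw, add_sub_add_left_eq_sub]
    have e1 : inversion w₁ - inversion w₂ ≠ 0 := by
      refine sub_ne_zero.mpr fun h => hw ?_
      rw [← inversion_inversion w₁, h, inversion_inversion]
    rw [normPow_eq_exp e1, log_norm_inversion_sub hw₁ hw₂ hw,
      normPow_eq_exp (sub_ne_zero.mpr hw), tau,
      show (D : ℂ) / 2 - kappa Δ₁ Δ₂ u + ((D + n - Δ) / 2 - u) - D / 2 =
        D / 2 - delta n Δ₁ Δ₂ Δ by simp only [kappa, delta]; ring,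
      show (D : ℂ) / 2 - (D / 2 - kappa Δ₁ Δ₂ u) = kappa Δ₁ Δ₂ u by ring,
      show (D : ℂ) / 2 - ((D + n - Δ) / 2 - u) + n =
        D / 2 - (D / 2 - delta n Δ₁ Δ₂ Δ) - kappa Δ₁ Δ₂ u + n by simp only [kappa, delta]; ring,
      show (D : ℂ) - (D / 2 - kappa Δ₁ Δ₂ u) - ((D + n - Δ) / 2 - u) + n =
        D / 2 - (D / 2 - delta n Δ₁ Δ₂ Δ) + n by simp only [kappa, delta]; ring,
      show ((D : ℂ) + n - Δ) / 2 - u = D / 2 - delta n Δ₁ Δ₂ Δ + kappa Δ₁ Δ₂ u by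
        simp only [kappa, delta]; ring]
    have e2 : Complex.exp (((Real.log ‖w₁ - w₂‖ - Real.log ‖w₁‖ - Real.log ‖w₂‖ : ℝ) : ℂ) *
          (2 * ((D : ℂ) / 2 - Δ₁))) *
        (Complex.exp (Real.log ‖w₁‖ * (D - 2 * kappa Δ₁ Δ₂ u) +
          Real.log ‖w₂‖ * (D + Δ₂ - Δ₁ - 2 * u)) *
        Complex.exp (Real.log ‖w₁ - w₂‖ * (D - 2 * (D / 2 - kappa Δ₁ Δ₂ u) -
          2 * (D / 2 - delta n Δ₁ Δ₂ Δ + kappa Δ₁ Δ₂ u)))) =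
        Complex.exp (-((Real.log ‖w₁ - w₂‖ - Real.log ‖w₁‖ - Real.log ‖w₂‖) *
          ((Δ₁ + Δ₂) / 2 + u + ((Δ₁ + Δ₂) / 2 - u) - Δ + n)) +
          Real.log ‖w₁‖ * ((Δ₁ + Δ₂) / 2 + u - ((Δ₁ + Δ₂) / 2 - u) + Δ - n) +
          Real.log ‖w₂‖ * ((Δ₁ + Δ₂) / 2 - u - ((Δ₁ + Δ₂) / 2 + u) + Δ - n)) := by
      simp only [← Complex.exp_add, kappa, delta]
      congr 1
      push_cast
      ring
    rw [← e2]
    ring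

/-! ### Gamma-function coefficients and parameter tubes -/

theorem GammaRegular.ne_zero {z : ℂ} (h : GammaRegular z) : Complex.Gamma z ≠ 0 :=
  Complex.Gamma_ne_zero h

theorem gammaRegular_of_re_pos {z : ℂ} (h : 0 < z.re) : GammaRegular z := by
  rintro m rfl
  simp only [Complex.neg_re, Complex.natCast_re] at h
  have : (0 : ℝ) ≤ m := m.cast_nonneg
  linarith

theorem four_cpow (s : ℂ) : (4 : ℂ) ^ s = (2 : ℂ) ^ (2 * s) := by
  have h4 := ofReal_cpow_eq_exp (x := 4) (by norm_num) s
  have h2 := ofReal_cpow_eq_exp (x := 2) (by norm_num) (2 * s)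
  have hl : Real.log 4 = 2 * Real.log 2 := by
    rw [show (4 : ℝ) = 2 ^ 2 by norm_num, Real.log_pow]
    norm_num
  rw [hl] at h4
  push_cast at h4 h2
  rw [h4, h2]
  ring_nf

/-- Γ(κ) and Γ(κ') occur in a(κ) and in τ in reciprocal positions; regularity makes both nonzero, so
they cancel. -/
theorem aCoeff_mul_tau_eq_qCoeff {D n : ℕ} {Δ₁ Δ₂ Δ u : ℂ} (h : GammaRegular (kappa Δ₁ Δ₂ u))
    (h' : GammaRegular ((D : ℂ) / 2 - kappa Δ₁ Δ₂ u)) :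
    aCoeff D (kappa Δ₁ Δ₂ u) * tau D ((D : ℂ) / 2 - delta n Δ₁ Δ₂ Δ) (kappa Δ₁ Δ₂ u) n =
      qCoeff D n Δ₁ Δ₂ Δ u := by
  have g1 := h.ne_zero
  have g2 := h'.ne_zero
  have hπ : (Real.pi : ℂ) ^ ((D : ℂ) / 2) ≠ 0 := by
    rw [ofReal_cpow_eq_exp Real.pi_pos]; exact Complex.exp_ne_zero _
  have e4 : (4 : ℂ) ^ ((Δ₂ - Δ₁) / 2 + u) = ((2 : ℂ) ^ (2 * kappa Δ₁ Δ₂ u))⁻¹ := by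
    rw [← Complex.cpow_neg, four_cpow, kappa]
    ring_nf
  rw [aCoeff, tau, qCoeff, e4,
    show (D : ℂ) / 2 - (D / 2 - delta n Δ₁ Δ₂ Δ) - kappa Δ₁ Δ₂ u + n = (Δ + n) / 2 + u by
      simp only [kappa, delta]; ring,
    show (D : ℂ) / 2 - (D / 2 - delta n Δ₁ Δ₂ Δ) + n = (Δ + n + Δ₁ - Δ₂) / 2 by
      simp only [delta]; ring,
    show (D : ℂ) / 2 - delta n Δ₁ Δ₂ Δ + kappa Δ₁ Δ₂ u = (D + n - Δ) / 2 - u by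
      simp only [kappa, delta]; ring,
    show (D : ℂ) / 2 - delta n Δ₁ Δ₂ Δ = (D + n - Δ + Δ₂ - Δ₁) / 2 by
      simp only [delta]; ring]
  generalize Complex.Gamma (kappa Δ₁ Δ₂ u) = G₁ at g1 ⊢
  generalize Complex.Gamma ((D : ℂ) / 2 - kappa Δ₁ Δ₂ u) = G₂ at g2 ⊢
  field_simp

theorem mem_QTube {D : ℕ} {Δ₁ Δ₂ Δ u : ℂ} : (Δ₁, Δ₂, Δ, u) ∈ QTube D ↔
    0 < (Δ₁.re - Δ₂.re) / 2 - u.re ∧ 0 < Δ.re + 2 * u.re ∧ Δ₁.re - Δ₂.re + Δ.re < D := by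
  simp [QTube, kappa]

theorem mem_RTube {D : ℕ} {Δ₁ Δ₂ Δ u : ℂ} : (Δ₁, Δ₂, Δ, u) ∈ RTube D ↔
    0 < (Δ₁.re - Δ₂.re) / 2 - u.re ∧ 0 < (Δ₂.re - Δ₁.re) / 2 - u.re ∧ 0 < Δ.re + 2 * u.re ∧
      Δ.re - 2 * u.re < D ∧ 0 < Δ₁.re - Δ₂.re + Δ.re ∧ Δ₁.re - Δ₂.re + Δ.re < D := by
  simp [RTube, kappa]

theorem isOpen_QTube (D : ℕ) : IsOpen (QTube D) := by
  simp only [QTube, kappa, ofPred_and]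
  refine IsOpen.inter ?_ (IsOpen.inter ?_ ?_)
  all_goals
    refine isOpen_lt ?_ ?_ <;> fun_prop

theorem isOpen_RTube (D : ℕ) : IsOpen (RTube D) := by
  simp only [RTube, kappa, ofPred_and]
  refine IsOpen.inter ?_ (IsOpen.inter ?_ (IsOpen.inter ?_ (IsOpen.inter ?_ (IsOpen.inter ?_ ?_))))
  all_goals
    refine isOpen_lt ?_ ?_ <;> fun_prop

theorem RTube_nonempty {D : ℕ} (hD : 1 ≤ D) : (RTube D).Nonempty := by
  -- With Δ₁ = Δ₂ = 0 a negative u makes κ and γ positive. For Δ = 1/2 and u = -1/8 one has Δ + 2u =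
  -- 1/4 and Δ - 2u = 3/4 < 1 ≤ D.
  refine ⟨(0, 0, ((1 / 2 : ℝ) : ℂ), ((-1 / 8 : ℝ) : ℂ)), ?_⟩
  have : (1 : ℝ) ≤ D := by exact_mod_cast hD
  rw [mem_RTube]
  simp only [Complex.zero_re, Complex.ofReal_re]
  refine ⟨?_, ?_, ?_, ?_, ?_, ?_⟩ <;> linarith

theorem RTube_subset_QTube (D : ℕ) : RTube D ⊆ QTube D :=
  fun _ h => ⟨h.1, h.2.2.1, h.2.2.2.2.2⟩

theorem one_le_dim {D : ℕ} {x y : Space D} (h : x ≠ y) : 1 ≤ D := by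
  rcases Nat.eq_zero_or_pos D with rfl | hD
  · exact absurd (Subsingleton.elim x y) h
  · exact hD

/-! ### Q and R inside the tubes of absolute convergence -/

/-- `Q(u)` on the conformal triangle inside the tube of absolute convergence. -/
theorem Qop_triangle {D n : ℕ} (μ : Fin n → Fin D) {x₁ x₂ x : Space D}
    (h₁₂ : x₁ ≠ x₂) (h₁ : x₁ ≠ x) (h₂ : x₂ ≠ x) {Δ₁ Δ₂ Δ u : ℂ}
    (hP : (Δ₁, Δ₂, Δ, u) ∈ QTube D) :
    QConverges Δ₁ Δ₂ u (triangle Δ₁ Δ₂ Δ μ x) x₁ x₂ ∧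
    Qop Δ₁ Δ₂ u (triangle Δ₁ Δ₂ Δ μ x) x₁ x₂ =
      aCoeff D (kappa Δ₁ Δ₂ u) * tau D ((D : ℂ) / 2 - delta n Δ₁ Δ₂ Δ) (kappa Δ₁ Δ₂ u) n *
        triangle ((Δ₁ + Δ₂) / 2 + u) ((Δ₁ + Δ₂) / 2 - u) Δ μ x x₁ x₂ := by
  obtain ⟨hi, hv⟩ := integral_qIntegrand μ h₁₂ h₁ h₂ hP
  refine ⟨hi, ?_⟩
  have e : Qop Δ₁ Δ₂ u (triangle Δ₁ Δ₂ Δ μ x) x₁ x₂ =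
      normPow (x₁ - x₂) (2 * ((D : ℂ) / 2 - Δ₁)) * (aCoeff D (-(u + (Δ₂ - Δ₁) / 2)) *
        ∫ y, qIntegrand Δ₁ Δ₂ Δ u μ x x₁ x₂ y) := rfl
  rw [e, mul_left_comm, hv, mul_assoc, show -(u + (Δ₂ - Δ₁) / 2) = kappa Δ₁ Δ₂ u by
    rw [kappa]; ring]

/-- In the tube 0 < Re κ < D/2, the upper bound coming from the other two inequalities, so both
forms of the coefficient apply. -/
theorem Qop_triangle_eq_qCoeff {D n : ℕ} (μ : Fin n → Fin D) {x₁ x₂ x : Space D}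
    (h₁₂ : x₁ ≠ x₂) (h₁ : x₁ ≠ x) (h₂ : x₂ ≠ x) {Δ₁ Δ₂ Δ u : ℂ}
    (hP : (Δ₁, Δ₂, Δ, u) ∈ QTube D) :
    Qop Δ₁ Δ₂ u (triangle Δ₁ Δ₂ Δ μ x) x₁ x₂ = qCoeff D n Δ₁ Δ₂ Δ u *
      triangle ((Δ₁ + Δ₂) / 2 + u) ((Δ₁ + Δ₂) / 2 - u) Δ μ x x₁ x₂ := by
  rw [(Qop_triangle μ h₁₂ h₁ h₂ hP).2]
  obtain ⟨h1, h2, h3⟩ := mem_QTube.mp hP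
  rw [aCoeff_mul_tau_eq_qCoeff (gammaRegular_of_re_pos ?_) (gammaRegular_of_re_pos ?_)]
  · simpa [kappa] using h1
  · simp [kappa]; linarith

theorem normPow_sub_comm {D : ℕ} (v w : Space D) (s : ℂ) : normPow (v - w) s = normPow (w - v) s := by
  rw [normPow, normPow, norm_sub_rev]

theorem triangle_swap {D n : ℕ} (Δ₁ Δ₂ Δ : ℂ) (μ : Fin n → Fin D) (x x₁ x₂ : Space D) :
    triangle Δ₁ Δ₂ Δ μ x x₁ x₂ = (-1) ^ n * triangle Δ₂ Δ₁ Δ μ x x₂ x₁ := by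
  obtain ⟨T, -, hT⟩ := exists_tracelessPower_eq_tensorPoly μ
  rw [triangle, triangle, hT, hT, ← neg_sub, tensorPoly_neg, normPow_sub_comm x₁ x₂,
    add_comm Δ₁ Δ₂]
  push_cast
  ring

/-- The integrand of the outer integral of `R(u)` on the conformal triangle. -/
theorem outer_integrand_eq {D n : ℕ} (μ : Fin n → Fin D) {x₁ x₂ x y : Space D}
    (h₂ : x₂ ≠ x) (hy : y ≠ x) (hy₂ : y ≠ x₂) {Δ₁ Δ₂ Δ u : ℂ} (hP : (Δ₁, Δ₂, Δ, u) ∈ QTube D) :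
    pKernel (u + (Δ₁ - Δ₂) / 2) x₁ y *
      p₁ (u + (Δ₂ - Δ₁) / 2) (q₁₂ (u + (Δ₁ + Δ₂ - D) / 2) (triangle Δ₁ Δ₂ Δ μ x)) x₂ y =
    ((-1) ^ n * qCoeff D n Δ₁ Δ₂ Δ u) *
      qIntegrand ((Δ₁ + Δ₂) / 2 - u) ((Δ₁ + Δ₂) / 2 + u) Δ ((Δ₁ - Δ₂) / 2) μ x x₁ x₂ y := by
  have h := Qop_triangle_eq_qCoeff μ hy₂.symm h₂ hy hP
  have e : Qop Δ₁ Δ₂ u (triangle Δ₁ Δ₂ Δ μ x) x₂ y = normPow (x₂ - y) (2 * ((D : ℂ) / 2 - Δ₁)) *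
      p₁ (u + (Δ₂ - Δ₁) / 2) (q₁₂ (u + (Δ₁ + Δ₂ - D) / 2) (triangle Δ₁ Δ₂ Δ μ x)) x₂ y := rfl
  have hv : y - x₂ ≠ 0 := sub_ne_zero.mpr hy₂
  -- The power that completes the inner integral to Q(u) is inverse to the power applied first by
  -- the second Q.
  have hm : normPow (y - x₂) (2 * ((Δ₁ - Δ₂) / 2 +
      ((Δ₁ + Δ₂) / 2 - u + ((Δ₁ + Δ₂) / 2 + u) - D) / 2)) *
      normPow (x₂ - y) (2 * ((D : ℂ) / 2 - Δ₁)) = 1 := by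
    rw [normPow_sub_comm x₂ y, normPow_eq_exp hv, normPow_eq_exp hv, ← Complex.exp_add,
      ← Complex.exp_zero]
    congr 1
    ring
  -- The inner result has arguments (x₂, y). The next Q integrates over its first argument, so y is
  -- moved there, interchanging the dimensions and giving (-1)^n.
  rw [e, triangle_swap] at h
  rw [qIntegrand, q₁₂, show (Δ₁ - Δ₂) / 2 + ((Δ₁ + Δ₂) / 2 + u - ((Δ₁ + Δ₂) / 2 - u)) / 2 =
    u + (Δ₁ - Δ₂) / 2 by ring]
  set N := normPow (y - x₂) (2 * ((Δ₁ - Δ₂) / 2 +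
      ((Δ₁ + Δ₂) / 2 - u + ((Δ₁ + Δ₂) / 2 + u) - D) / 2))
  linear_combination pKernel (u + (Δ₁ - Δ₂) / 2) x₁ y * N * h - pKernel (u + (Δ₁ - Δ₂) / 2) x₁ y *
    p₁ (u + (Δ₂ - Δ₁) / 2) (q₁₂ (u + (Δ₁ + Δ₂ - D) / 2) (triangle Δ₁ Δ₂ Δ μ x)) x₂ y * hm

/-- The coefficients of the two successive Q share the two Gamma factors assumed regular, in
reciprocal positions; these cancel, and with them all dependence on Δ₁ and Δ₂. -/
theorem rEigenvalue_eq_mul_qCoeff {D n : ℕ} {Δ₁ Δ₂ Δ u : ℂ}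
    (h : GammaRegular (((D : ℂ) + n - Δ + Δ₂ - Δ₁) / 2))
    (h' : GammaRegular ((Δ + n + Δ₁ - Δ₂) / 2)) :
    rEigenvalue D n Δ u = (-1) ^ n * qCoeff D n Δ₁ Δ₂ Δ u *
      qCoeff D n ((Δ₁ + Δ₂) / 2 - u) ((Δ₁ + Δ₂) / 2 + u) Δ ((Δ₁ - Δ₂) / 2) := by
  have g1 := h.ne_zero
  have g2 := h'.ne_zero
  have e4 : (4 : ℂ) ^ (2 * u) = (4 : ℂ) ^ ((Δ₂ - Δ₁) / 2 + u) *
      (4 : ℂ) ^ (((Δ₁ + Δ₂) / 2 + u - ((Δ₁ + Δ₂) / 2 - u)) / 2 + (Δ₁ - Δ₂) / 2) := by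
    rw [← Complex.cpow_add _ _ (by norm_num)]
    ring_nf
  rw [rEigenvalue, qCoeff, qCoeff, e4,
    show (Δ + n) / 2 + (Δ₁ - Δ₂) / 2 = (Δ + n + Δ₁ - Δ₂) / 2 by ring,
    show ((D : ℂ) + n - Δ + ((Δ₁ + Δ₂) / 2 + u) - ((Δ₁ + Δ₂) / 2 - u)) / 2 =
      (D - Δ + n) / 2 + u by ring,
    show ((D : ℂ) + n - Δ) / 2 - (Δ₁ - Δ₂) / 2 = (D + n - Δ + Δ₂ - Δ₁) / 2 by ring,
    show (Δ + n + ((Δ₁ + Δ₂) / 2 - u) - ((Δ₁ + Δ₂) / 2 + u)) / 2 = (Δ + n) / 2 - u by ring,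
    show ((D : ℂ) + n - Δ) / 2 - u = (D - Δ + n) / 2 - u by ring]
  generalize Complex.Gamma (((D : ℂ) + n - Δ + Δ₂ - Δ₁) / 2) = G₁ at g1 ⊢
  generalize Complex.Gamma ((Δ + n + Δ₁ - Δ₂) / 2) = G₂ at g2 ⊢
  field_simp

/-- The Gamma factors independent of u are common to q(u) and q(-u), and only they need to be
nonzero. The others are inverted one by one, with division by zero giving zero on both sides. -/
theorem rEigenvalue_eq_div_qCoeff {D n : ℕ} {Δ₁ Δ₂ Δ u : ℂ}
    (h : GammaRegular ((D : ℂ) / 2 - delta n Δ₁ Δ₂ Δ))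
    (h' : GammaRegular ((Δ + n + Δ₁ - Δ₂) / 2)) :
    rEigenvalue D n Δ u =
      (-1) ^ n * (qCoeff D n Δ₁ Δ₂ Δ u / qCoeff D n Δ₁ Δ₂ Δ (-u)) := by
  have g1 := h.ne_zero
  have g2 := h'.ne_zero
  have g3 : (4 : ℂ) ^ ((Δ₂ - Δ₁) / 2 + -u) ≠ 0 := by
    rw [Ne, Complex.cpow_eq_zero_iff]; norm_num
  rw [show (D : ℂ) / 2 - delta n Δ₁ Δ₂ Δ = (D + n - Δ + Δ₂ - Δ₁) / 2 by
    simp only [delta]; ring] at g1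
  have e4 : (4 : ℂ) ^ ((Δ₂ - Δ₁) / 2 + u) =
      (4 : ℂ) ^ (2 * u) * (4 : ℂ) ^ ((Δ₂ - Δ₁) / 2 + -u) := by
    rw [← Complex.cpow_add _ _ (by norm_num)]
    ring_nf
  rw [rEigenvalue, qCoeff, qCoeff, e4, ← sub_eq_add_neg ((Δ + n) / 2) u, sub_neg_eq_add,
    show ((D : ℂ) + n - Δ) / 2 = (D - Δ + n) / 2 by ring]
  generalize Complex.Gamma (((D : ℂ) + n - Δ + Δ₂ - Δ₁) / 2) = G₁ at g1 ⊢
  generalize Complex.Gamma ((Δ + n + Δ₁ - Δ₂) / 2) = G₂ at g2 ⊢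
  generalize (4 : ℂ) ^ ((Δ₂ - Δ₁) / 2 + -u) = G₃ at g3 ⊢
  field_simp

/-- `R(u)` on the conformal triangle inside the tube of absolute convergence. -/
theorem Rop_triangle {D n : ℕ} (μ : Fin n → Fin D) {x₁ x₂ x : Space D}
    (h₁₂ : x₁ ≠ x₂) (h₁ : x₁ ≠ x) (h₂ : x₂ ≠ x) {Δ₁ Δ₂ Δ u : ℂ}
    (hP : (Δ₁, Δ₂, Δ, u) ∈ RTube D) :
    RConverges Δ₁ Δ₂ u (triangle Δ₁ Δ₂ Δ μ x) x₁ x₂ ∧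
    Rop Δ₁ Δ₂ u (triangle Δ₁ Δ₂ Δ μ x) x₁ x₂ =
      rEigenvalue D n Δ u * triangle Δ₁ Δ₂ Δ μ x x₁ x₂ := by
  have : Nontrivial (Space D) := ⟨x₁, x₂, h₁₂⟩
  have hQ := RTube_subset_QTube D hP
  obtain ⟨k1, k2, k3, k4, k5, k6⟩ := mem_RTube.mp hP
  have hn : (0 : ℝ) ≤ n := n.cast_nonneg
  -- For the second Q the new κ is γ, the new Δ + 2u is Δ + Δ₁ - Δ₂, and the new Δ₁ - Δ₂ + Δ is Δ -
  -- 2u. These are the remaining conditions of the tube for R(u).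
  have hQ' : ((Δ₁ + Δ₂) / 2 - u, (Δ₁ + Δ₂) / 2 + u, Δ, (Δ₁ - Δ₂) / 2) ∈ QTube D := by
    rw [mem_QTube]
    simp only [Complex.sub_re, Complex.add_re, Complex.div_ofNat_re]
    refine ⟨?_, ?_, ?_⟩ <;> linarith
  have key := ((ae_ne_point x).and (ae_ne_point x₂)).mono fun y hy =>
    outer_integrand_eq (x₁ := x₁) μ h₂ hy.1 hy.2 hQ
  obtain ⟨hi, -⟩ := integral_qIntegrand μ h₁₂ h₁ h₂ hQ'
  refine ⟨⟨?_, ?_⟩, ?_⟩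
  · filter_upwards [ae_ne_point x, ae_ne_point x₂] with y hy hy₂
    exact (Qop_triangle μ hy₂.symm h₂ hy hQ).1
  · exact (hi.const_mul _).congr (key.mono fun y hy => hy.symm)
  · have e : Rop Δ₁ Δ₂ u (triangle Δ₁ Δ₂ Δ μ x) x₁ x₂ =
        normPow (x₂ - x₁) (2 * (u + (D - Δ₁ - Δ₂) / 2)) * (aCoeff D (-(u + (Δ₁ - Δ₂) / 2)) *
          ∫ y, pKernel (u + (Δ₁ - Δ₂) / 2) x₁ y * p₁ (u + (Δ₂ - Δ₁) / 2)
            (q₁₂ (u + (Δ₁ + Δ₂ - D) / 2) (triangle Δ₁ Δ₂ Δ μ x)) x₂ y) := rfl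
    have e' : Qop ((Δ₁ + Δ₂) / 2 - u) ((Δ₁ + Δ₂) / 2 + u) ((Δ₁ - Δ₂) / 2)
        (triangle ((Δ₁ + Δ₂) / 2 - u) ((Δ₁ + Δ₂) / 2 + u) Δ μ x) x₁ x₂ =
        normPow (x₁ - x₂) (2 * ((D : ℂ) / 2 - ((Δ₁ + Δ₂) / 2 - u))) *
          (aCoeff D (-((Δ₁ - Δ₂) / 2 + ((Δ₁ + Δ₂) / 2 + u - ((Δ₁ + Δ₂) / 2 - u)) / 2)) *
          ∫ y, qIntegrand ((Δ₁ + Δ₂) / 2 - u) ((Δ₁ + Δ₂) / 2 + u) Δ ((Δ₁ - Δ₂) / 2)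
            μ x x₁ x₂ y) := rfl
    have h := Qop_triangle_eq_qCoeff μ h₁₂ h₁ h₂ hQ'
    rw [e', show (Δ₁ - Δ₂) / 2 + ((Δ₁ + Δ₂) / 2 + u - ((Δ₁ + Δ₂) / 2 - u)) / 2 =
        u + (Δ₁ - Δ₂) / 2 by ring,
      show (D : ℂ) / 2 - ((Δ₁ + Δ₂) / 2 - u) = u + (D - Δ₁ - Δ₂) / 2 by ring,
      show ((Δ₁ + Δ₂) / 2 - u + ((Δ₁ + Δ₂) / 2 + u)) / 2 + (Δ₁ - Δ₂) / 2 = Δ₁ by ring,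
      show ((Δ₁ + Δ₂) / 2 - u + ((Δ₁ + Δ₂) / 2 + u)) / 2 - (Δ₁ - Δ₂) / 2 = Δ₂ by ring] at h
    rw [e, integral_congr_ae key, integral_const_mul, normPow_sub_comm x₂ x₁,
      rEigenvalue_eq_mul_qCoeff (Δ₁ := Δ₁) (Δ₂ := Δ₂) (gammaRegular_of_re_pos ?_)
        (gammaRegular_of_re_pos ?_)]
    · linear_combination ((-1) ^ n * qCoeff D n Δ₁ Δ₂ Δ u) * h
    · simp; linarith
    · simp; linarith

/-! ### Meromorphic continuation in the parameters -/

theorem differentiable_triangle {D n : ℕ} (μ : Fin n → Fin D) {x₁ x₂ x : Space D}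
    (h₁₂ : x₁ ≠ x₂) (h₁ : x₁ ≠ x) (h₂ : x₂ ≠ x) {a b c : Params → ℂ} (ha : Differentiable ℂ a)
    (hb : Differentiable ℂ b) (hc : Differentiable ℂ c) :
    Differentiable ℂ fun P => triangle (a P) (b P) (c P) μ x x₁ x₂ := by
  simp only [triangle, normPow_eq_exp (sub_ne_zero.mpr h₁₂),
    normPow_eq_exp (sub_ne_zero.mpr h₁.symm), normPow_eq_exp (sub_ne_zero.mpr h₂.symm),
    ← Complex.exp_add, div_eq_mul_inv, ← Complex.exp_neg]
  fun_prop

theorem differentiable_inv_Gamma {f : Params → ℂ} (hf : Differentiable ℂ f) :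
    Differentiable ℂ fun P => (Complex.Gamma (f P))⁻¹ :=
  Complex.differentiable_one_div_Gamma.comp hf

theorem differentiable_four_cpow {f : Params → ℂ} (hf : Differentiable ℂ f) :
    Differentiable ℂ fun P => (4 : ℂ) ^ f P :=
  hf.const_cpow (.inl (by norm_num))

/-- The denominator h is the product of 1/Γ over the Gamma functions in the numerator of q(u), and g
is h q(u) times the triangle; both are entire. The regularity hypotheses say that h does not vanish
at the point. -/
theorem Qop_continuesTo {D n : ℕ} (μ : Fin n → Fin D) {x₁ x₂ x : Space D}
    (h₁₂ : x₁ ≠ x₂) (h₁ : x₁ ≠ x) (h₂ : x₂ ≠ x) {Δ₁ Δ₂ Δ u : ℂ}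
    (hB : GammaRegular ((D : ℂ) / 2 - delta n Δ₁ Δ₂ Δ)) (hA : GammaRegular ((Δ + n) / 2 + u)) :
    ContinuesTo (QTube D)
      (fun P : Params => Qop P.1 P.2.1 P.2.2.2 (triangle P.1 P.2.1 P.2.2.1 μ x) x₁ x₂)
      (Δ₁, Δ₂, Δ, u)
      (qCoeff D n Δ₁ Δ₂ Δ u *
        triangle ((Δ₁ + Δ₂) / 2 + u) ((Δ₁ + Δ₂) / 2 - u) Δ μ x x₁ x₂) := by
  refine ⟨isOpen_QTube D, (RTube_nonempty (one_le_dim h₁₂)).mono (RTube_subset_QTube D),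
    fun P => (4 : ℂ) ^ ((P.2.1 - P.1) / 2 + P.2.2.2) *
      ((Complex.Gamma ((D + n - P.2.2.1) / 2 - P.2.2.2))⁻¹ *
        (Complex.Gamma ((P.2.2.1 + n + P.1 - P.2.1) / 2))⁻¹) *
      triangle ((P.1 + P.2.1) / 2 + P.2.2.2) ((P.1 + P.2.1) / 2 - P.2.2.2) P.2.2.1 μ x x₁ x₂,
    fun P => (Complex.Gamma ((P.2.2.1 + n) / 2 + P.2.2.2))⁻¹ *
      (Complex.Gamma ((D + n - P.2.2.1 + P.2.1 - P.1) / 2))⁻¹, ?_, ?_, ?_, ?_, ?_⟩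
  · exact ((differentiable_four_cpow (by fun_prop)).mul
      ((differentiable_inv_Gamma (by fun_prop)).mul (differentiable_inv_Gamma (by fun_prop)))).mul
      (differentiable_triangle μ h₁₂ h₁ h₂ (by fun_prop) (by fun_prop) (by fun_prop))
  · exact (differentiable_inv_Gamma (by fun_prop)).mul (differentiable_inv_Gamma (by fun_prop))
  · rintro ⟨Δ₁, Δ₂, Δ, u⟩ hP
    -- Inside the tube both numerator arguments have positive real part, so multiplication by h
    -- cancels them.
    obtain ⟨k1, k2, k3⟩ := mem_QTube.mp hP
    have hn : (0 : ℝ) ≤ n := n.cast_nonneg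
    have g1 : Complex.Gamma ((Δ + n) / 2 + u) ≠ 0 :=
      Complex.Gamma_ne_zero_of_re_pos (by simp; linarith)
    have g2 : Complex.Gamma (((D : ℂ) + n - Δ + Δ₂ - Δ₁) / 2) ≠ 0 :=
      Complex.Gamma_ne_zero_of_re_pos (by simp; linarith)
    simp only
    rw [Qop_triangle_eq_qCoeff μ h₁₂ h₁ h₂ hP, qCoeff]
    generalize Complex.Gamma ((Δ + n) / 2 + u) = G₁ at g1 ⊢
    generalize Complex.Gamma (((D : ℂ) + n - Δ + Δ₂ - Δ₁) / 2) = G₂ at g2 ⊢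
    field_simp
  all_goals
    have g1 := hA.ne_zero
    have g2 := hB.ne_zero
    rw [show (D : ℂ) / 2 - delta n Δ₁ Δ₂ Δ = (D + n - Δ + Δ₂ - Δ₁) / 2 by
      simp only [delta]; ring] at g2
  · exact mul_ne_zero (inv_ne_zero g1) (inv_ne_zero g2)
  · simp only [qCoeff]
    generalize Complex.Gamma ((Δ + n) / 2 + u) = G₁ at g1 ⊢
    generalize Complex.Gamma (((D : ℂ) + n - Δ + Δ₂ - Δ₁) / 2) = G₂ at g2 ⊢
    field_simp

/-- As for Q(u), with h built from the two numerator Gamma functions of the eigenvalue. These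
involve only Δ and u, so Δ₁ and Δ₂ are unrestricted. -/
theorem Rop_continuesTo {D n : ℕ} (μ : Fin n → Fin D) {x₁ x₂ x : Space D}
    (h₁₂ : x₁ ≠ x₂) (h₁ : x₁ ≠ x) (h₂ : x₂ ≠ x) (Δ₁ Δ₂ : ℂ) {Δ u : ℂ}
    (hA : GammaRegular ((Δ + n) / 2 + u)) (hB : GammaRegular (((D : ℂ) - Δ + n) / 2 + u)) :
    ContinuesTo (RTube D)
      (fun P : Params => Rop P.1 P.2.1 P.2.2.2 (triangle P.1 P.2.1 P.2.2.1 μ x) x₁ x₂)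
      (Δ₁, Δ₂, Δ, u)
      (rEigenvalue D n Δ u * triangle Δ₁ Δ₂ Δ μ x x₁ x₂) := by
  refine ⟨isOpen_RTube D, RTube_nonempty (one_le_dim h₁₂),
    fun P => (-1) ^ n * (4 : ℂ) ^ (2 * P.2.2.2) *
      ((Complex.Gamma ((P.2.2.1 + n) / 2 - P.2.2.2))⁻¹ *
        (Complex.Gamma ((D - P.2.2.1 + n) / 2 - P.2.2.2))⁻¹) *
      triangle P.1 P.2.1 P.2.2.1 μ x x₁ x₂,
    fun P => (Complex.Gamma ((P.2.2.1 + n) / 2 + P.2.2.2))⁻¹ *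
      (Complex.Gamma ((D - P.2.2.1 + n) / 2 + P.2.2.2))⁻¹, ?_, ?_, ?_, ?_, ?_⟩
  · exact (((differentiable_four_cpow (by fun_prop)).const_mul _).mul
      ((differentiable_inv_Gamma (by fun_prop)).mul (differentiable_inv_Gamma (by fun_prop)))).mul
      (differentiable_triangle μ h₁₂ h₁ h₂ (by fun_prop) (by fun_prop) (by fun_prop))
  · exact (differentiable_inv_Gamma (by fun_prop)).mul (differentiable_inv_Gamma (by fun_prop))
  · rintro ⟨Δ₁, Δ₂, Δ, u⟩ hP
    obtain ⟨k1, k2, k3, k4, k5, k6⟩ := mem_RTube.mp hP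
    have hn : (0 : ℝ) ≤ n := n.cast_nonneg
    have g1 : Complex.Gamma ((Δ + n) / 2 + u) ≠ 0 :=
      Complex.Gamma_ne_zero_of_re_pos (by simp; linarith)
    have g2 : Complex.Gamma (((D : ℂ) - Δ + n) / 2 + u) ≠ 0 :=
      Complex.Gamma_ne_zero_of_re_pos (by simp; linarith)
    simp only
    rw [(Rop_triangle μ h₁₂ h₁ h₂ hP).2, rEigenvalue]
    generalize Complex.Gamma ((Δ + n) / 2 + u) = G₁ at g1 ⊢
    generalize Complex.Gamma (((D : ℂ) - Δ + n) / 2 + u) = G₂ at g2 ⊢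
    field_simp
  · exact mul_ne_zero (inv_ne_zero hA.ne_zero) (inv_ne_zero hB.ne_zero)
  · have g1 := hA.ne_zero
    have g2 := hB.ne_zero
    simp only [rEigenvalue]
    generalize Complex.Gamma ((Δ + n) / 2 + u) = G₁ at g1 ⊢
    generalize Complex.Gamma (((D : ℂ) - Δ + n) / 2 + u) = G₂ at g2 ⊢
    field_simp

end ConformalTriangle

open ConformalTriangle in
theorem proposition8 (D n : ℕ) (μ : Fin n → Fin D) (x₁ x₂ x : Space D)
    (h₁₂ : x₁ ≠ x₂) (h₁ : x₁ ≠ x) (h₂ : x₂ ≠ x) (Δ₁ Δ₂ Δ u : ℂ) :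
    -- `Q(u)` on the conformal triangle, where the integral converges absolutely
    ((Δ₁, Δ₂, Δ, u) ∈ QTube D →
      QConverges Δ₁ Δ₂ u (triangle Δ₁ Δ₂ Δ μ x) x₁ x₂ ∧
      Qop Δ₁ Δ₂ u (triangle Δ₁ Δ₂ Δ μ x) x₁ x₂ =
        aCoeff D (kappa Δ₁ Δ₂ u) *
          tau D ((D : ℂ) / 2 - delta n Δ₁ Δ₂ Δ) (kappa Δ₁ Δ₂ u) n *
          triangle ((Δ₁ + Δ₂) / 2 + u) ((Δ₁ + Δ₂) / 2 - u) Δ μ x x₁ x₂) ∧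
    -- `Q(u)` on the conformal triangle, by continuation in the parameters
    (GammaRegular ((D : ℂ) / 2 - delta n Δ₁ Δ₂ Δ) → GammaRegular ((Δ + n) / 2 + u) →
      ContinuesTo (QTube D)
        (fun P : Params => Qop P.1 P.2.1 P.2.2.2 (triangle P.1 P.2.1 P.2.2.1 μ x) x₁ x₂)
        (Δ₁, Δ₂, Δ, u)
        (qCoeff D n Δ₁ Δ₂ Δ u *
          triangle ((Δ₁ + Δ₂) / 2 + u) ((Δ₁ + Δ₂) / 2 - u) Δ μ x x₁ x₂)) ∧
    -- the two forms of the coefficient agree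
    (GammaRegular (kappa Δ₁ Δ₂ u) → GammaRegular ((D : ℂ) / 2 - kappa Δ₁ Δ₂ u) →
      aCoeff D (kappa Δ₁ Δ₂ u) *
          tau D ((D : ℂ) / 2 - delta n Δ₁ Δ₂ Δ) (kappa Δ₁ Δ₂ u) n =
        qCoeff D n Δ₁ Δ₂ Δ u) ∧
    -- the eigenvalue of `R(u)` is `(-1)^n` times the ratio of the coefficients at `u` and `-u`
    (GammaRegular ((D : ℂ) / 2 - delta n Δ₁ Δ₂ Δ) → GammaRegular ((Δ + n + Δ₁ - Δ₂) / 2) →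
      rEigenvalue D n Δ u =
        (-1) ^ n * (qCoeff D n Δ₁ Δ₂ Δ u / qCoeff D n Δ₁ Δ₂ Δ (-u))) ∧
    -- `R(u)` on the conformal triangle, where the iterated integral converges absolutely
    ((Δ₁, Δ₂, Δ, u) ∈ RTube D →
      RConverges Δ₁ Δ₂ u (triangle Δ₁ Δ₂ Δ μ x) x₁ x₂ ∧
      Rop Δ₁ Δ₂ u (triangle Δ₁ Δ₂ Δ μ x) x₁ x₂ =
        rEigenvalue D n Δ u * triangle Δ₁ Δ₂ Δ μ x x₁ x₂) ∧
    -- `R(u)` on the conformal triangle, by continuation in the parameters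
    (GammaRegular ((Δ + n) / 2 + u) → GammaRegular (((D : ℂ) - Δ + n) / 2 + u) →
      ContinuesTo (RTube D)
        (fun P : Params => Rop P.1 P.2.1 P.2.2.2 (triangle P.1 P.2.1 P.2.2.1 μ x) x₁ x₂)
        (Δ₁, Δ₂, Δ, u)
        (rEigenvalue D n Δ u * triangle Δ₁ Δ₂ Δ μ x x₁ x₂)) := by
  exact ⟨Qop_triangle μ h₁₂ h₁ h₂, Qop_continuesTo μ h₁₂ h₁ h₂, aCoeff_mul_tau_eq_qCoeff,
    rEigenvalue_eq_div_qCoeff, Rop_triangle μ h₁₂ h₁ h₂, Rop_continuesTo μ h₁₂ h₁ h₂ Δ₁ Δ₂⟩
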